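/- Let $L>0$ and consider the surface growth equation $$\partial_t h=-\partial_x^4h-\partial_x^2\big((\partial_xh)^2\big)\qquad(\ast)$$ for real-valued $h(t,x)$ that are $L$-periodic in $x$ with $\int_0^Lh\,dx=0$. For $s>0$ let $$\dot H^s=\Big\{u\in L^2(0,L):\ u(\cdot+L)=u(\cdot),\ u_0=0,\ \sum_{k\ne0}|k|^{2s}|u_k|^2<\infty\Big\},\qquad |u|_s^2=\sum_{k\neq0}|k|^{2s}|u_k|^2,$$ where $u_k$ is the $k$-th Fourier coefficient of $u$. **Proposition 2.8.** Let $n\ge1$ be an integer and let $h_0\in\dot H^n$. Then there exist $T>0$ and $$h\in C([0,T);\dot H^n)\cap L^2_{\mathrm{loc}}([0,T);\dot H^{n+2})$$ with $h(0)=h_0$ that solves $(\ast)$ in the sense of distributions on $(0,T)\times\mathbb R/L\mathbb Z$, that is, $$\int_0^T\!\!\int_0^L\big(h\,\partial_t\varphi-h\,\partial_x^4\varphi-(\partial_xh)^2\,\partial_x^2\varphi\big)\,dx\,dt=0$$ for every smooth $\varphi:\mathbb R\times\mathbb R\to\mathbb R$ that is $L$-periodic in $x$ and vanishes for $t$ outside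 some compact subset of $(0,T)$. Here $L^2_{\mathrm{loc}}([0,T);\cdot)$ means square integrability on $(0,T')$ for every $T'<T$. -/

import Mathlib

open MeasureTheory Set
open scoped ContDiff ENNReal

noncomputable section

namespace SurfaceGrowth

/-- The space `L²(0,L)` of real valued functions, seen as `L`-periodic functions, that is, as
functions on the circle `ℝ / Lℤ`. The measure `haarAddCircle` is Lebesgue measure divided
by `L`; this changes neither the functions nor their almost everywhere classes. -/
abbrev L2 (L : ℝ) [Fact (0 < L)] : Type :=
  Lp ℝ 2 (AddCircle.haarAddCircle : Measure (AddCircle L))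

/-- The `k`-th Fourier coefficient
`u_k = (1/L) ∫₀ᴸ u(x) exp(-2πikx/L) dx` of a real valued `u ∈ L²(0,L)`. -/
def coeff {L : ℝ} [Fact (0 < L)] (u : L2 L) (k : ℤ) : ℂ :=
  fourierCoeff (fun x : AddCircle L => ((u x : ℝ) : ℂ)) k

section Linear

variable {L : ℝ} [Fact (0 < L)]

theorem coeff_add (u v : L2 L) (k : ℤ) : coeff (u + v) k = coeff u k + coeff v k := by
  have hu : Integrable (fun x : AddCircle L => ((u x : ℝ) : ℂ)) AddCircle.haarAddCircle :=
    ((Lp.memLp u).integrable (by norm_num)).ofReal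
  have hv : Integrable (fun x : AddCircle L => ((v x : ℝ) : ℂ)) AddCircle.haarAddCircle :=
    ((Lp.memLp v).integrable (by norm_num)).ofReal
  unfold coeff
  rw [← Pi.add_apply, ← fourierCoeff.add hu hv]
  unfold fourierCoeff
  refine integral_congr_ae ?_
  filter_upwards [Lp.coeFn_add u v] with x hx
  rw [hx]
  simp only [Pi.add_apply, Complex.ofReal_add, smul_add]

theorem coeff_smul (c : ℝ) (u : L2 L) (k : ℤ) : coeff (c • u) k = (c : ℂ) * coeff u k := by
  unfold coeff
  rw [← fourierCoeff.const_mul]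
  unfold fourierCoeff
  refine integral_congr_ae ?_
  filter_upwards [Lp.coeFn_smul c u] with x hx
  rw [hx]
  simp

theorem coeff_zero (k : ℤ) : coeff (0 : L2 L) k = 0 := by
  simpa using coeff_smul (0 : ℝ) (0 : L2 L) k

theorem eq_zero_of_coeff (u : L2 L) (h : ∀ k, coeff u k = 0) : u = 0 := by
  have h1 : Complex.ofRealCLM.compLp u = 0 := by
    apply (fourierBasis (T := L)).repr.injective
    ext k
    rw [map_zero, fourierBasis_repr]
    refine Eq.trans ?_ (h k)
    unfold coeff fourierCoeff
    refine integral_congr_ae ?_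
    filter_upwards [ContinuousLinearMap.coeFn_compLp Complex.ofRealCLM u] with x hx
    simp [hx]
  rw [Lp.eq_zero_iff_ae_eq_zero] at h1 ⊢
  filter_upwards [h1, ContinuousLinearMap.coeFn_compLp Complex.ofRealCLM u] with x hx hx'
  rw [hx] at hx'
  simpa using hx'.symm

end Linear

/-- The weighted coefficients `|k|^s u_k`. -/
def weighted {L : ℝ} [Fact (0 < L)] (s : ℝ) (u : L2 L) (k : ℤ) : ℂ :=
  ((|(k : ℝ)| ^ s : ℝ) : ℂ) * coeff u k

theorem norm_weighted_sq {L : ℝ} [Fact (0 < L)] (s : ℝ) (u : L2 L) (k : ℤ) :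
    ‖weighted s u k‖ ^ 2 = |(k : ℝ)| ^ (2 * s) * ‖coeff u k‖ ^ 2 := by
  have h : |(k : ℝ)| ^ (2 * s) = (|(k : ℝ)| ^ s) ^ 2 := by
    rw [mul_comm, Real.rpow_mul (abs_nonneg _)]
    norm_num
  rw [weighted, norm_mul, mul_pow, h, Complex.norm_real, Real.norm_eq_abs, sq_abs]

theorem memlp_weighted_iff {L : ℝ} [Fact (0 < L)] (s : ℝ) (u : L2 L) :
    Memℓp (weighted s u) 2 ↔ Summable fun k : ℤ => |(k : ℝ)| ^ (2 * s) * ‖coeff u k‖ ^ 2 := by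
  rw [memℓp_gen_iff (by norm_num)]
  simp only [ENNReal.toReal_ofNat, Real.rpow_two, norm_weighted_sq]

theorem weighted_add {L : ℝ} [Fact (0 < L)] (s : ℝ) (u v : L2 L) :
    weighted s (u + v) = weighted s u + weighted s v := by
  funext k
  simp only [weighted, Pi.add_apply, coeff_add]
  ring

theorem weighted_smul {L : ℝ} [Fact (0 < L)] (s c : ℝ) (u : L2 L) :
    weighted s (c • u) = c • weighted s u := by
  funext k
  simp only [weighted, Pi.smul_apply, coeff_smul, Complex.real_smul]
  ring

/-- The functions `u ∈ L²(0,L)`, `L`-periodic, with `u_0 = 0` and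
`∑_{k ≠ 0} |k|^{2s} |u_k|² < ∞`, as a linear subspace (the term `k = 0` vanishes since
`u_0 = 0`). Only exponents `s > 0` are used. -/
def hdotSubmodule (L : ℝ) [Fact (0 < L)] (s : ℝ) : Submodule ℝ (L2 L) where
  carrier := {u | coeff u 0 = 0 ∧
    Summable fun k : ℤ => |(k : ℝ)| ^ (2 * s) * ‖coeff u k‖ ^ 2}
  zero_mem' := by simp [coeff_zero]
  add_mem' := by
    rintro u v ⟨hu0, hu⟩ ⟨hv0, hv⟩
    refine ⟨by simp [coeff_add, hu0, hv0], ?_⟩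
    rw [← memlp_weighted_iff] at hu hv ⊢
    rw [weighted_add]
    exact hu.add hv
  smul_mem' := by
    rintro c u ⟨hu0, hu⟩
    refine ⟨by simp [coeff_smul, hu0], ?_⟩
    rw [← memlp_weighted_iff] at hu ⊢
    rw [weighted_smul]
    exact hu.const_smul c

/-- The homogeneous Sobolev space `Ḣ^s`. It is a type of its own, because it carries the norm
`|u|_s = (∑_{k ≠ 0} |k|^{2s} |u_k|²)^{1/2}`, not the norm of `L²`. -/
def HDot (L : ℝ) [Fact (0 < L)] (s : ℝ) : Type := hdotSubmodule L s

namespace HDot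

variable {L : ℝ} [Fact (0 < L)] {s : ℝ}

instance : AddCommGroup (HDot L s) := inferInstanceAs (AddCommGroup (hdotSubmodule L s))

instance : Module ℝ (HDot L s) := inferInstanceAs (Module ℝ (hdotSubmodule L s))

/-- The inclusion of `Ḣ^s` into `L²`. -/
def toL2 : HDot L s →ₗ[ℝ] L2 L := (hdotSubmodule L s).subtype

/-- The linear map `u ↦ (|k|^s u_k)_k` from `Ḣ^s` to `ℓ²(ℤ)`, whose `ℓ²` norm is the norm
of `Ḣ^s`. -/
def toSeq : HDot L s →ₗ[ℝ] lp (fun _ : ℤ => ℂ) 2 where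
  toFun u := ⟨weighted s (toL2 u), (memlp_weighted_iff s (toL2 u)).2 u.2.2⟩
  map_add' u v := by
    apply Subtype.ext
    simp only [map_add, weighted_add]
    rfl
  map_smul' c u := by
    apply Subtype.ext
    simp only [map_smul, weighted_smul]
    rfl

theorem toSeq_injective : Function.Injective (toSeq : HDot L s →ₗ[ℝ] _) := by
  rw [injective_iff_map_eq_zero]
  intro u hu
  apply Subtype.ext
  refine eq_zero_of_coeff (toL2 u) fun k => ?_
  by_cases hk : k = 0
  · rw [hk]
    exact u.2.1
  · have h1 : weighted s (toL2 u) k = 0 := congrFun (congrArg Subtype.val hu) k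
    have h2 : |(k : ℝ)| ^ s ≠ 0 :=
      (Real.rpow_pos_of_pos (abs_pos.2 (Int.cast_ne_zero.2 hk)) s).ne'
    rw [weighted, mul_eq_zero, Complex.ofReal_eq_zero] at h1
    exact h1.resolve_left h2

instance : NormedAddCommGroup (HDot L s) :=
  NormedAddCommGroup.induced (HDot L s) (lp (fun _ : ℤ => ℂ) 2) toSeq toSeq_injective

/-- The norm of `Ḣ^s` is `|u|_s² = ∑_k |k|^{2s} |u_k|²`. -/
theorem norm_sq_eq (u : HDot L s) :
    ‖u‖ ^ 2 = ∑' k : ℤ, |(k : ℝ)| ^ (2 * s) * ‖coeff (toL2 u) k‖ ^ 2 := by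
  have h := lp.norm_rpow_eq_tsum (p := 2) (by norm_num) (toSeq u)
  simp only [ENNReal.toReal_ofNat, Real.rpow_two] at h
  refine Eq.trans h (tsum_congr fun k => ?_)
  exact norm_weighted_sq s (toL2 u) k

end HDot

/-- `v` is the weak (distributional) derivative of `u` on the circle: for every smooth
`L`-periodic `φ`, `∫₀ᴸ u φ' dx = - ∫₀ᴸ v φ dx`. -/
def IsWeakDeriv {L : ℝ} [Fact (0 < L)] (u v : L2 L) : Prop :=
  ∀ φ : ℝ → ℝ, ContDiff ℝ ∞ φ → Function.Periodic φ L →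
    ∫ x in (0 : ℝ)..L, u (x : AddCircle L) * deriv φ x =
      - ∫ x in (0 : ℝ)..L, v (x : AddCircle L) * φ x

/-- Test functions `φ(t, x)` on `(0,T) × ℝ/Lℤ`: smooth, `L`-periodic in `x`, and supported in
`[a,b] × ℝ` for some compact interval `[a,b]` inside `(0,T)`. -/
structure IsTestFunction (L T : ℝ) (φ : ℝ → ℝ → ℝ) : Prop where
  smooth : ContDiff ℝ ∞ (fun p : ℝ × ℝ => φ p.1 p.2)
  periodic : ∀ t, Function.Periodic (φ t) L
  support : ∃ a b : ℝ, 0 < a ∧ b < T ∧ ∀ t, t ∉ Icc a b → ∀ x, φ t x = 0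

/-- `∫₀ᴸ (h φ_t - h φ_xxxx - (h_x)² φ_xx) dx` at time `t`, where `u = h(t)` and `v = h_x(t)`. -/
def testedEquation {L : ℝ} [Fact (0 < L)] (φ : ℝ → ℝ → ℝ) (t : ℝ) (u v : L2 L) : ℝ :=
  ∫ x in (0 : ℝ)..L,
    (u (x : AddCircle L) * deriv (fun τ => φ τ x) t
      - u (x : AddCircle L) * iteratedDeriv 4 (φ t) x
      - v (x : AddCircle L) ^ 2 * iteratedDeriv 2 (φ t) x)

/-- `h` solves `∂_t h = - ∂_x⁴ h - ∂_x² (∂_x h)²`, with `L`-periodic boundary conditions, in the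
sense of distributions on `(0,T)`: each `h(t)` has a weak derivative `h_x(t)` in `L²`, and the
equation holds when tested against every test function. -/
def IsSolution {L : ℝ} [Fact (0 < L)] (T : ℝ) (h : ℝ → L2 L) : Prop :=
  ∃ hx : ℝ → L2 L, (∀ t ∈ Ioo 0 T, IsWeakDeriv (h t) (hx t)) ∧
    ∀ φ : ℝ → ℝ → ℝ, IsTestFunction L T φ →
      IntervalIntegrable (fun t => testedEquation φ t (h t) (hx t)) volume 0 T ∧
      ∫ t in (0 : ℝ)..T, testedEquation φ t (h t) (hx t) = 0

/-- `h ∈ L²_loc([0,T); Ḣ^s)`: for almost every `t ∈ (0,T)` the function `h(t)` is in `Ḣ^s`, and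
`t ↦ h(t)` is (strongly) measurable into `Ḣ^s` with square integrable norm on every `(0,T')`
with `T' < T`. -/
def MemL2Loc {L : ℝ} [Fact (0 < L)] (T s : ℝ) (h : ℝ → L2 L) : Prop :=
  ∃ g : ℝ → HDot L s,
    (∀ᵐ t ∂(volume.restrict (Ioo 0 T)), (g t).toL2 = h t) ∧
    ∀ T' : ℝ, T' < T → MemLp g 2 (volume.restrict (Ioo 0 T'))

end SurfaceGrowth

end

/-!
The equation is solved on the level of Fourier coefficients. With `ν = 2π/L`, the coefficients of a
solution satisfy
`a_k' = -(ν k)⁴ a_k - ν⁴ k² ∑_j j (k - j) a_j a_{k-j}`,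
and Duhamel's formula turns this into a fixed point equation.

The weight `exp (|k| t^{1/4})` makes one contraction give existence and regularity together. It is
compatible with convolutions because `|k| ≤ |j| + |k - j|`, it is compatible with Duhamel's formula
because `t ↦ t^{1/4}` is subadditive, and it costs only half of the dissipation, because
`|k| r^{1/4} - (ν k)⁴ r / 2` is bounded above (`exists_heat_le`). Since `|k| ≤ 2 |j| |k - j|` for
nonzero `j` and `k - j`, the weighted convolution is bounded by the squared `ℓ²` norm of the
weighted sequence `|k|^n a_k` (`pow_mul_norm_derivConv_le`). Hence for data in `Ḣ^n`, `n ≥ 1`, the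
nonlinear part `a_k - exp (-(ν k)⁴ t) c_k`, where `c_k = a_k(0)`, can be found in the form
`exp (-|k| t^{1/4}) |k|^{-n-3/4} y_k` with `y` in the unit ball of the bounded continuous functions
on `ℤ × ℝ`: the Duhamel integral is then bounded by a power of the length of the time interval
(`norm_profile_inv_smul_duhamel_le`), and Banach's fixed point theorem applies
(`exists_eq_duhamelMap`).

The bound `|a_k(t)| ≤ exp (-(ν k)⁴ t) |c_k| + exp (-|k| t^{1/4}) |k|^{-n-3/4}` carries the rest.
Its supremum in time is square summable against `|k|^{2n}`, which gives continuity in `Ḣ^n` by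
dominated convergence. The time integral of its square is summable against `|k|^{2n+4}`, because
`∫ exp (-2 |k| t^{1/4}) dt` is a multiple of `k^{-4}`, which gives square integrability in
`Ḣ^{n+2}`. Away from `t = 0` it decays faster than any power of `k`, so that the Fourier series of
`h`, `h_x` and `h_x²` converge absolutely and the weak formulation can be evaluated mode by mode.
The contribution of each mode is the time derivative of a function with compact support in
`(0, T)` (`integral_modeTerm`).
-/

noncomputable section

namespace SurfaceGrowth

/-! ### Exponential weights and convolutions -/

/-- The weight `exp (-|k| t^{1/4})`. It is supermultiplicative in `k`, hence compatible with
convolutions, and the exponent `1/4` matches the parabolic scaling `t ∼ |k|^{-4}`. -/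
def decay (t : ℝ) (k : ℤ) : ℝ := Real.exp (-(|(k : ℝ)| * t ^ (1 / 4 : ℝ)))

theorem decay_pos (t : ℝ) (k : ℤ) : 0 < decay t k := Real.exp_pos _

theorem decay_neg (t : ℝ) (k : ℤ) : decay t (-k) = decay t k := by simp [decay]

theorem decay_le_one {t : ℝ} (ht : 0 ≤ t) (k : ℤ) : decay t k ≤ 1 := by
  unfold decay
  rw [Real.exp_le_one_iff]
  have := mul_nonneg (abs_nonneg (k : ℝ)) (Real.rpow_nonneg ht (1 / 4))
  linarith

theorem decay_anti {s t : ℝ} (hs : 0 ≤ s) (hst : s ≤ t) (k : ℤ) : decay t k ≤ decay s k := by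
  unfold decay
  gcongr

theorem decay_mul_le {t : ℝ} (ht : 0 ≤ t) (j l : ℤ) :
    decay t j * decay t l ≤ decay t (j + l) := by
  unfold decay
  rw [← Real.exp_add, Real.exp_le_exp]
  have h1 : |((j + l : ℤ) : ℝ)| ≤ |(j : ℝ)| + |(l : ℝ)| := by
    push_cast
    exact abs_add_le _ _
  have h2 := mul_le_mul_of_nonneg_right h1 (Real.rpow_nonneg ht (1 / 4))
  linarith

theorem decay_mul_decay_sub_le {s t : ℝ} (hs : 0 ≤ s) (hst : s ≤ t) (k : ℤ) :
    decay s k * decay (t - s) k ≤ decay t k := by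
  unfold decay
  rw [← Real.exp_add, Real.exp_le_exp]
  have h1 := Real.rpow_add_le_add_rpow (p := 1 / 4) hs (sub_nonneg.2 hst) (by norm_num)
    (by norm_num)
  rw [add_sub_cancel] at h1
  have h2 := mul_le_mul_of_nonneg_left h1 (abs_nonneg (k : ℝ))
  linarith

theorem continuous_decay (k : ℤ) : Continuous fun t => decay t k := by
  unfold decay
  have : Continuous fun t : ℝ => t ^ (1 / 4 : ℝ) := Real.continuous_rpow_const (by norm_num)
  fun_prop

/-- Half of the decay of the linear semigroup pays for the weight `decay`. -/
theorem exists_heat_le {ν : ℝ} (hν : 0 < ν) : ∃ K : ℝ, 1 ≤ K ∧ ∀ (k : ℤ) (r : ℝ), 0 ≤ r →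
    Real.exp (-((ν * k) ^ 4 * r)) ≤
      K * (decay r k * Real.exp (-((ν * k) ^ 4 / 2 * r))) := by
  set ε : ℝ := ν ^ 4 / 2 with hε
  have hε0 : 0 < ε := by positivity
  have hi : 0 < 1 / ε := by positivity
  refine ⟨Real.exp (1 + 1 / ε), Real.one_le_exp (by positivity), fun k r hr => ?_⟩
  unfold decay
  rw [← Real.exp_add, ← Real.exp_add, Real.exp_le_exp]
  set z : ℝ := |(k : ℝ)| * r ^ (1 / 4 : ℝ) with hz
  have hz0 : 0 ≤ z := mul_nonneg (abs_nonneg _) (Real.rpow_nonneg hr _)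
  have hz4 : z ^ 4 = (k : ℝ) ^ 4 * r := by
    rw [hz, mul_pow, ← abs_pow, abs_of_nonneg (by positivity), ← Real.rpow_natCast (r ^ _),
      ← Real.rpow_mul hr]
    norm_num
  have hlam : (ν * k) ^ 4 * r = 2 * (ε * z ^ 4) := by rw [hz4, hε]; ring
  have hlam' : (ν * k) ^ 4 / 2 * r = ε * z ^ 4 := by rw [hz4, hε]; ring
  rw [hlam, hlam']
  -- `z` is the exponent of `decay`, and `ε * z ^ 4` half the exponent of the semigroup
  have key : z ≤ 1 + 1 / ε + ε * z ^ 4 := by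
    rcases le_total z (1 + 1 / ε) with h | h
    · have : 0 ≤ ε * z ^ 4 := by positivity
      linarith
    · have h1 : 1 ≤ z := by linarith
      have h2 : 1 ≤ ε * z := by
        have := mul_le_mul_of_nonneg_left h hε0.le
        rw [mul_add, mul_one_div_cancel hε0.ne'] at this
        linarith
      have h3 : 1 ≤ z ^ 2 := one_le_pow₀ h1
      have h4 : 1 ≤ ε * z * z ^ 2 := one_le_mul_of_one_le_of_one_le h2 h3
      have h5 : z * 1 ≤ z * (ε * z * z ^ 2) := mul_le_mul_of_nonneg_left h4 hz0
      have h6 : z * (ε * z * z ^ 2) = ε * z ^ 4 := by ring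
      linarith
  linarith

/-- The convolution `∑_j (j a_j) ((k - j) b_{k-j})`. Up to the factor `-(2π/L)²`, it is the `k`-th
Fourier coefficient of the product of the derivatives of two functions with coefficients `a`
and `b`. -/
def derivConv (a b : ℤ → ℂ) (k : ℤ) : ℂ :=
  ∑' j : ℤ, ((j : ℂ) * a j) * (((k - j : ℤ) : ℂ) * b (k - j))

theorem abs_int_le_pow (j : ℤ) (p : ℕ) : |(j : ℝ)| ≤ |(j : ℝ)| ^ (p + 1) := by
  rcases eq_or_ne j 0 with rfl | hj
  · simp
  · have : (1 : ℝ) ≤ |(j : ℝ)| := by exact_mod_cast Int.one_le_abs hj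
    exact le_self_pow₀ this (by omega)

theorem abs_int_add_pow_mul_le (j l : ℤ) (p : ℕ) :
    |((j + l : ℤ) : ℝ)| ^ p * (|(j : ℝ)| * |(l : ℝ)|) ≤
      2 ^ p * (|(j : ℝ)| ^ (p + 1) * |(l : ℝ)| ^ (p + 1)) := by
  rcases eq_or_ne j 0 with rfl | hj
  · simp
  rcases eq_or_ne l 0 with rfl | hl
  · simp
  have h1 : (1 : ℝ) ≤ |(j : ℝ)| := by exact_mod_cast Int.one_le_abs hj
  have h2 : (1 : ℝ) ≤ |(l : ℝ)| := by exact_mod_cast Int.one_le_abs hl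
  have h3 : |((j + l : ℤ) : ℝ)| ≤ 2 * (|(j : ℝ)| * |(l : ℝ)|) := by
    push_cast
    have := abs_add_le (j : ℝ) (l : ℝ)
    nlinarith
  calc |((j + l : ℤ) : ℝ)| ^ p * (|(j : ℝ)| * |(l : ℝ)|)
      ≤ (2 * (|(j : ℝ)| * |(l : ℝ)|)) ^ p * (|(j : ℝ)| * |(l : ℝ)|) := by gcongr
    _ = _ := by ring

section Convolution

variable {p : ℕ} {t D E : ℝ} {W : ℤ → ℝ} {a b : ℤ → ℂ}

theorem norm_derivConv_term_le (ht : 0 ≤ t)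
    (ha : ∀ k : ℤ, |(k : ℝ)| ^ (p + 1) * ‖a k‖ ≤ D * W k * decay t k)
    (hb : ∀ k : ℤ, |(k : ℝ)| ^ (p + 1) * ‖b k‖ ≤ E * W k * decay t k) (j l : ℤ) :
    ‖((j : ℂ) * a j) * ((l : ℂ) * b l)‖ ≤ D * E * (W j * W l) := by
  have hj : 0 ≤ D * W j * decay t j := le_trans (by positivity) (ha j)
  have hj' : D * W j * decay t j ≤ D * W j := by
    have : 0 ≤ D * W j := nonneg_of_mul_nonneg_left hj (decay_pos t j)
    exact mul_le_of_le_one_right this (decay_le_one ht j)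
  have hl : 0 ≤ E * W l * decay t l := le_trans (by positivity) (hb l)
  have hl' : E * W l * decay t l ≤ E * W l := by
    have : 0 ≤ E * W l := nonneg_of_mul_nonneg_left hl (decay_pos t l)
    exact mul_le_of_le_one_right this (decay_le_one ht l)
  have h1 : ‖(j : ℂ) * a j‖ ≤ D * W j := by
    rw [norm_mul, Complex.norm_intCast]
    exact (mul_le_mul_of_nonneg_right (abs_int_le_pow j p) (norm_nonneg _)).trans
      ((ha j).trans hj')
  have h2 : ‖(l : ℂ) * b l‖ ≤ E * W l := by
    rw [norm_mul, Complex.norm_intCast]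
    exact (mul_le_mul_of_nonneg_right (abs_int_le_pow l p) (norm_nonneg _)).trans
      ((hb l).trans hl')
  rw [norm_mul]
  refine (mul_le_mul h1 h2 (norm_nonneg _) (hj.trans hj')).trans (le_of_eq (by ring))

theorem pow_mul_norm_derivConv_term_le (ht : 0 ≤ t) (hD : 0 ≤ D) (hE : 0 ≤ E) (hW : ∀ k, 0 ≤ W k)
    (ha : ∀ k : ℤ, |(k : ℝ)| ^ (p + 1) * ‖a k‖ ≤ D * W k * decay t k)
    (hb : ∀ k : ℤ, |(k : ℝ)| ^ (p + 1) * ‖b k‖ ≤ E * W k * decay t k) (j l : ℤ) :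
    |((j + l : ℤ) : ℝ)| ^ p * ‖((j : ℂ) * a j) * ((l : ℂ) * b l)‖ ≤
      2 ^ p * (D * E) * decay t (j + l) * (W j * W l) := by
  rw [norm_mul, norm_mul, norm_mul, Complex.norm_intCast, Complex.norm_intCast]
  calc |((j + l : ℤ) : ℝ)| ^ p * (|(j : ℝ)| * ‖a j‖ * (|(l : ℝ)| * ‖b l‖))
      = |((j + l : ℤ) : ℝ)| ^ p * (|(j : ℝ)| * |(l : ℝ)|) * (‖a j‖ * ‖b l‖) := by ring
    _ ≤ 2 ^ p * (|(j : ℝ)| ^ (p + 1) * |(l : ℝ)| ^ (p + 1)) * (‖a j‖ * ‖b l‖) :=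
        mul_le_mul_of_nonneg_right (abs_int_add_pow_mul_le j l p) (by positivity)
    _ = 2 ^ p * ((|(j : ℝ)| ^ (p + 1) * ‖a j‖) * (|(l : ℝ)| ^ (p + 1) * ‖b l‖)) := by ring
    _ ≤ 2 ^ p * ((D * W j * decay t j) * (E * W l * decay t l)) := by
        refine mul_le_mul_of_nonneg_left (mul_le_mul (ha j) (hb l) (by positivity) ?_)
          (by positivity)
        exact le_trans (by positivity) (ha j)
    _ = 2 ^ p * (D * E) * (W j * W l) * (decay t j * decay t l) := by ring
    _ ≤ 2 ^ p * (D * E) * (W j * W l) * decay t (j + l) := by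
        refine mul_le_mul_of_nonneg_left (decay_mul_le ht j l) ?_
        have := hW j
        have := hW l
        positivity
    _ = _ := by ring

theorem summable_mul_sub (hW2 : Summable fun k => W k ^ 2) (k : ℤ) :
    Summable fun j => W j * W (k - j) := by
  have h2 : Summable fun j => W (k - j) ^ 2 :=
    (Equiv.subLeft k).summable_iff.2 hW2
  refine Summable.of_norm_bounded ((hW2.add h2)) fun j => ?_
  rw [Real.norm_eq_abs, abs_le]
  constructor <;> nlinarith [sq_nonneg (W j + W (k - j)), sq_nonneg (W j - W (k - j)),
    sq_nonneg (W j), sq_nonneg (W (k - j))]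

theorem tsum_mul_sub_le (hW2 : Summable fun k => W k ^ 2) (k : ℤ) :
    ∑' j, W j * W (k - j) ≤ ∑' j, W j ^ 2 := by
  have h2 : Summable fun j => W (k - j) ^ 2 :=
    (Equiv.subLeft k).summable_iff.2 hW2
  have h3 : ∑' j, W (k - j) ^ 2 = ∑' j, W j ^ 2 :=
    (Equiv.subLeft k).tsum_eq fun j => W j ^ 2
  calc ∑' j, W j * W (k - j) ≤ ∑' j, ((1 / 2) * W j ^ 2 + (1 / 2) * W (k - j) ^ 2) := by
        refine Summable.tsum_le_tsum (fun j => ?_) (summable_mul_sub hW2 k)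
          ((hW2.mul_left _).add (h2.mul_left _))
        nlinarith [sq_nonneg (W j - W (k - j))]
    _ = ∑' j, W j ^ 2 := by
        rw [(hW2.mul_left _).tsum_add (h2.mul_left _), tsum_mul_left, tsum_mul_left, h3]
        ring

theorem summable_derivConv (ht : 0 ≤ t) (hW2 : Summable fun k => W k ^ 2)
    (ha : ∀ k : ℤ, |(k : ℝ)| ^ (p + 1) * ‖a k‖ ≤ D * W k * decay t k)
    (hb : ∀ k : ℤ, |(k : ℝ)| ^ (p + 1) * ‖b k‖ ≤ E * W k * decay t k) (k : ℤ) :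
    Summable fun j : ℤ => ((j : ℂ) * a j) * (((k - j : ℤ) : ℂ) * b (k - j)) :=
  Summable.of_norm_bounded ((summable_mul_sub hW2 k).mul_left (D * E))
    fun j => norm_derivConv_term_le ht ha hb j (k - j)

/-- The weights `|k|^n` are submultiplicative up to a constant on nonzero integers, which bounds
the nonlinearity by the `ℓ²` norm of the weighted coefficients without any loss. -/
theorem pow_mul_norm_derivConv_le (ht : 0 ≤ t) (hD : 0 ≤ D) (hE : 0 ≤ E) (hW : ∀ k, 0 ≤ W k)
    (hW2 : Summable fun k => W k ^ 2)
    (ha : ∀ k : ℤ, |(k : ℝ)| ^ (p + 1) * ‖a k‖ ≤ D * W k * decay t k)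
    (hb : ∀ k : ℤ, |(k : ℝ)| ^ (p + 1) * ‖b k‖ ≤ E * W k * decay t k) (k : ℤ) :
    |(k : ℝ)| ^ p * ‖derivConv a b k‖ ≤ 2 ^ p * (D * E) * (∑' j, W j ^ 2) * decay t k := by
  have hs := (summable_derivConv ht hW2 ha hb k).norm
  calc |(k : ℝ)| ^ p * ‖derivConv a b k‖
      ≤ |(k : ℝ)| ^ p * ∑' j : ℤ, ‖((j : ℂ) * a j) * (((k - j : ℤ) : ℂ) * b (k - j))‖ := by
        gcongr
        exact norm_tsum_le_tsum_norm hs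
    _ = ∑' j : ℤ, |(k : ℝ)| ^ p * ‖((j : ℂ) * a j) * (((k - j : ℤ) : ℂ) * b (k - j))‖ :=
        tsum_mul_left.symm
    _ ≤ ∑' j : ℤ, 2 ^ p * (D * E) * decay t k * (W j * W (k - j)) := by
        refine Summable.tsum_le_tsum (fun j => ?_) (hs.mul_left _)
          ((summable_mul_sub hW2 k).mul_left _)
        have := pow_mul_norm_derivConv_term_le ht hD hE hW ha hb j (k - j)
        rwa [add_sub_cancel] at this
    _ = 2 ^ p * (D * E) * decay t k * ∑' j : ℤ, W j * W (k - j) := tsum_mul_left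
    _ ≤ 2 ^ p * (D * E) * decay t k * ∑' j, W j ^ 2 := by
        have := decay_pos t k
        exact mul_le_mul_of_nonneg_left (tsum_mul_sub_le hW2 k) (by positivity)
    _ = _ := by ring

theorem derivConv_self_sub (ht : 0 ≤ t) (hW2 : Summable fun k => W k ^ 2) {D' : ℝ}
    (ha : ∀ k : ℤ, |(k : ℝ)| ^ (p + 1) * ‖a k‖ ≤ D * W k * decay t k)
    (hb : ∀ k : ℤ, |(k : ℝ)| ^ (p + 1) * ‖b k‖ ≤ E * W k * decay t k)
    (hab : ∀ k : ℤ, |(k : ℝ)| ^ (p + 1) * ‖(a - b) k‖ ≤ D' * W k * decay t k) (k : ℤ) :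
    derivConv a a k - derivConv b b k = derivConv (a - b) a k + derivConv b (a - b) k := by
  unfold derivConv
  rw [← (summable_derivConv ht hW2 ha ha k).tsum_sub (summable_derivConv ht hW2 hb hb k),
    ← (summable_derivConv ht hW2 hab ha k).tsum_add (summable_derivConv ht hW2 hb hab k)]
  refine tsum_congr fun j => ?_
  simp only [Pi.sub_apply]
  ring

theorem derivConv_neg_eq_conj (ha : ∀ k, a (-k) = starRingEnd ℂ (a k)) (k : ℤ) :
    derivConv a a (-k) = starRingEnd ℂ (derivConv a a k) := by
  unfold derivConv
  rw [Complex.conj_tsum, ← (Equiv.neg ℤ).tsum_eq]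
  refine tsum_congr fun j => ?_
  have h : -k - -j = -(k - j) := by ring
  simp only [Equiv.neg_apply, h, ha, map_mul, map_intCast]
  push_cast
  ring

end Convolution

/-! ### Duhamel's formula for a single Fourier mode -/

/-- The solution at time `t` of `z' = -(ν k)⁴ z + f`, `z(0) = 0`. -/
def duhamel (ν : ℝ) (k : ℤ) (f : ℝ → ℂ) (t : ℝ) : ℂ :=
  ∫ s in (0 : ℝ)..t, Real.exp (-((ν * k) ^ 4 * (t - s))) • f s

theorem duhamel_zero (ν : ℝ) (k : ℤ) (f : ℝ → ℂ) : duhamel ν k f 0 = 0 :=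
  intervalIntegral.integral_same

theorem duhamel_eq_smul (ν : ℝ) (k : ℤ) (f : ℝ → ℂ) (t : ℝ) :
    duhamel ν k f t =
      Real.exp (-((ν * k) ^ 4 * t)) • ∫ s in (0 : ℝ)..t, Real.exp ((ν * k) ^ 4 * s) • f s := by
  unfold duhamel
  rw [← intervalIntegral.integral_smul]
  refine intervalIntegral.integral_congr fun s _ => ?_
  simp only [smul_smul, ← Real.exp_add]
  congr 2
  ring

theorem hasDerivAt_duhamel (ν : ℝ) (k : ℤ) {f : ℝ → ℂ} (hf : Continuous f) (t : ℝ) :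
    HasDerivAt (duhamel ν k f) (-((ν * k) ^ 4) • duhamel ν k f t + f t) t := by
  have h0 : duhamel ν k f = fun t => Real.exp (-((ν * k) ^ 4 * t)) •
      ∫ s in (0 : ℝ)..t, Real.exp ((ν * k) ^ 4 * s) • f s := funext (duhamel_eq_smul ν k f)
  have hg : Continuous fun s => Real.exp ((ν * k) ^ 4 * s) • f s := by fun_prop
  have h1 : HasDerivAt (fun t => ∫ s in (0 : ℝ)..t, Real.exp ((ν * k) ^ 4 * s) • f s)
      (Real.exp ((ν * k) ^ 4 * t) • f t) t :=
    intervalIntegral.integral_hasDerivAt_right (hg.intervalIntegrable _ _)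
      (hg.stronglyMeasurableAtFilter _ _) hg.continuousAt
  have h2 : HasDerivAt (fun t : ℝ => Real.exp (-((ν * k) ^ 4 * t)))
      (Real.exp (-((ν * k) ^ 4 * t)) * -((ν * k) ^ 4)) t := by
    have : HasDerivAt (fun t : ℝ => -((ν * k) ^ 4 * t)) (-((ν * k) ^ 4 * 1)) t :=
      ((hasDerivAt_id t).const_mul _).neg
    simpa using this.exp
  have h3 := h2.smul h1
  rw [h0]
  refine h3.congr_deriv ?_
  rw [smul_smul, ← Real.exp_add, neg_add_cancel, Real.exp_zero, one_smul, add_comm, smul_smul,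
    mul_comm (Real.exp _)]

theorem continuous_duhamel (ν : ℝ) (k : ℤ) {f : ℝ → ℂ} (hf : Continuous f) :
    Continuous (duhamel ν k f) :=
  continuous_iff_continuousAt.2 fun t => (hasDerivAt_duhamel ν k hf t).continuousAt

theorem duhamel_sub (ν : ℝ) (k : ℤ) {f g : ℝ → ℂ} (hf : Continuous f) (hg : Continuous g)
    (t : ℝ) : duhamel ν k (f - g) t = duhamel ν k f t - duhamel ν k g t := by
  unfold duhamel
  rw [← intervalIntegral.integral_sub]
  · simp only [Pi.sub_apply, smul_sub]
  · exact Continuous.intervalIntegrable (by fun_prop) _ _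
  · exact Continuous.intervalIntegrable (by fun_prop) _ _

theorem duhamel_neg_conj (ν : ℝ) (k : ℤ) (f : ℝ → ℂ) (t : ℝ) :
    duhamel ν (-k) (fun s => starRingEnd ℂ (f s)) t = starRingEnd ℂ (duhamel ν k f t) := by
  have h : (ν * ((-k : ℤ) : ℝ)) ^ 4 = (ν * k) ^ 4 := by push_cast; ring
  simp only [duhamel, intervalIntegral, h, map_sub, ← integral_conj, Complex.real_smul, map_mul,
    Complex.conj_ofReal]

/-- A forcing term dominated by the weight `decay` has a Duhamel integral dominated by the same
weight, with a factor of the size of the time or of the inverse of the dissipation rate. -/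
theorem norm_duhamel_le {ν K F t : ℝ} {k : ℤ} (hν : 0 < ν) (hk : k ≠ 0) (hK0 : 0 ≤ K)
    (hK : ∀ r : ℝ, 0 ≤ r → Real.exp (-((ν * k) ^ 4 * r)) ≤
      K * (decay r k * Real.exp (-((ν * k) ^ 4 / 2 * r))))
    (ht : 0 ≤ t) (hF : 0 ≤ F) {f : ℝ → ℂ}
    (hf : ∀ s ∈ Icc 0 t, ‖f s‖ ≤ F * decay s k) :
    ‖duhamel ν k f t‖ ≤ F * K * decay t k * min t (2 / (ν * k) ^ 4) := by
  set lam : ℝ := (ν * k) ^ 4 with hlam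
  have hlam0 : 0 < lam := by
    have : (k : ℝ) ≠ 0 := Int.cast_ne_zero.2 hk
    positivity
  have hd := decay_pos t k
  have hc : Continuous fun s => F * K * decay t k * Real.exp (-(lam / 2 * (t - s))) := by
    fun_prop
  have h1 : ‖duhamel ν k f t‖ ≤
      ∫ s in (0 : ℝ)..t, F * K * decay t k * Real.exp (-(lam / 2 * (t - s))) := by
    refine intervalIntegral.norm_integral_le_of_norm_le ht (Filter.Eventually.of_forall ?_)
      (hc.intervalIntegrable _ _)
    intro s hs
    have hs0 : 0 ≤ s := hs.1.le
    have hst : 0 ≤ t - s := sub_nonneg.2 hs.2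
    rw [norm_smul, Real.norm_eq_abs, abs_of_pos (Real.exp_pos _)]
    have hds := decay_pos s k
    have hdts := decay_pos (t - s) k
    calc Real.exp (-(lam * (t - s))) * ‖f s‖
        ≤ (K * (decay (t - s) k * Real.exp (-(lam / 2 * (t - s))))) * (F * decay s k) :=
          mul_le_mul (hK _ hst) (hf s ⟨hs0, hs.2⟩) (norm_nonneg _) (by positivity)
      _ = F * K * Real.exp (-(lam / 2 * (t - s))) * (decay s k * decay (t - s) k) := by ring
      _ ≤ F * K * Real.exp (-(lam / 2 * (t - s))) * decay t k :=
          mul_le_mul_of_nonneg_left (decay_mul_decay_sub_le hs0 hs.2 k) (by positivity)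
      _ = _ := by ring
  refine h1.trans ?_
  rw [intervalIntegral.integral_const_mul]
  refine mul_le_mul_of_nonneg_left (le_min ?_ ?_) (by positivity)
  · calc ∫ s in (0 : ℝ)..t, Real.exp (-(lam / 2 * (t - s)))
        ≤ ∫ _ in (0 : ℝ)..t, (1 : ℝ) := by
          refine intervalIntegral.integral_mono_on ht
            (Continuous.intervalIntegrable (by fun_prop) _ _)
            (Continuous.intervalIntegrable (by fun_prop) _ _) fun s hs => ?_
          rw [Real.exp_le_one_iff, neg_nonpos]
          exact mul_nonneg (by positivity) (sub_nonneg.2 hs.2)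
      _ = t := by simp
  · have h2 : ∀ s ∈ uIcc 0 t, HasDerivAt (fun s => 2 / lam * Real.exp (-(lam / 2 * (t - s))))
        (Real.exp (-(lam / 2 * (t - s)))) s := by
      intro s _
      have h3 : HasDerivAt (fun s => -(lam / 2 * (t - s))) (-(lam / 2 * (-1))) s :=
        (((hasDerivAt_id s).const_sub t).const_mul (lam / 2)).neg
      refine (h3.exp.const_mul (2 / lam)).congr_deriv ?_
      field_simp
    rw [intervalIntegral.integral_eq_sub_of_hasDerivAt h2
      (Continuous.intervalIntegrable (by fun_prop) _ _)]
    have := Real.exp_pos (-(lam / 2 * (t - 0)))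
    have h4 : 0 ≤ 2 / lam * Real.exp (-(lam / 2 * (t - 0))) := by positivity
    simp only [sub_self, mul_zero, neg_zero, Real.exp_zero, mul_one]
    linarith

/-- The gain of a small power of the time: `15/4 < 4`, so that a factor `|k|^{15/4}` is absorbed by
the dissipation `(ν k)⁴` with `t^{1/16}` to spare. -/
theorem rpow_mul_min_le {ν δ t : ℝ} {k : ℤ} (hν : 0 < ν) (hk : k ≠ 0) (hδ : 0 < δ)
    (ht : t ≤ δ ^ 16) :
    |(k : ℝ)| ^ (15 / 4 : ℝ) * min t (2 / (ν * k) ^ 4) ≤ (1 + 2 / ν ^ 4) * δ := by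
  have hk0 : 0 < |(k : ℝ)| := abs_pos.2 (Int.cast_ne_zero.2 hk)
  obtain ⟨x, hx0, hx⟩ : ∃ x : ℝ, 0 < x ∧ |(k : ℝ)| = x ^ 4 := by
    refine ⟨|(k : ℝ)| ^ (1 / 4 : ℝ), Real.rpow_pos_of_pos hk0 _, ?_⟩
    rw [← Real.rpow_natCast, ← Real.rpow_mul hk0.le]
    norm_num
  have h15 : |(k : ℝ)| ^ (15 / 4 : ℝ) = x ^ 15 := by
    rw [hx, ← Real.rpow_natCast x 4, ← Real.rpow_mul hx0.le, ← Real.rpow_natCast x 15]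
    norm_num
  have h16 : (ν * k) ^ 4 = ν ^ 4 * x ^ 16 := by
    rw [mul_pow, ← Even.pow_abs (by decide : Even 4) (k : ℝ), hx]
    ring
  have hν4 : 0 < 2 / ν ^ 4 := by positivity
  rw [h15, h16]
  -- low frequencies use the factor `t`, high frequencies the dissipation
  rcases le_total (x * δ) 1 with h | h
  · calc x ^ 15 * min t (2 / (ν ^ 4 * x ^ 16)) ≤ x ^ 15 * δ ^ 16 := by
          gcongr
          exact (min_le_left _ _).trans ht
      _ = (x * δ) ^ 15 * δ := by ring
      _ ≤ 1 * δ := by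
          gcongr
          exact pow_le_one₀ (by positivity) h
      _ ≤ _ := by
          gcongr
          linarith
  · calc x ^ 15 * min t (2 / (ν ^ 4 * x ^ 16)) ≤ x ^ 15 * (2 / (ν ^ 4 * x ^ 16)) := by
          gcongr
          exact min_le_right _ _
      _ = 2 / ν ^ 4 * (1 / x) := by
          field_simp
      _ ≤ 2 / ν ^ 4 * δ := by
          gcongr
          rw [div_le_iff₀ hx0]
          linarith
      _ ≤ _ := by
          gcongr
          linarith

/-! ### The fixed point equation for the Fourier coefficients -/

/-- The projection of the real line to `[0, T]`. -/
def clamp (T t : ℝ) : ℝ := max 0 (min t T)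

theorem clamp_nonneg (T t : ℝ) : 0 ≤ clamp T t := le_max_left _ _

theorem clamp_le {T : ℝ} (hT : 0 ≤ T) (t : ℝ) : clamp T t ≤ T := max_le hT (min_le_right _ _)

theorem clamp_of_mem {T t : ℝ} (ht : t ∈ Icc 0 T) : clamp T t = t := by
  rw [clamp, min_eq_left ht.2, max_eq_right ht.1]

theorem continuous_clamp (T : ℝ) : Continuous (clamp T) := by
  unfold clamp
  fun_prop

/-- The scale factor of the unknown in the fixed point equation: for the solution with initial
datum in `Ḣ^{p+1}`, the difference to the linear evolution is sought in the form
`profile p t k * y k` with bounded `y`. -/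
def profile (p : ℕ) (t : ℝ) (k : ℤ) : ℝ := decay t k * |(k : ℝ)| ^ (-((p : ℝ) + 7 / 4))

theorem profile_nonneg (p : ℕ) (t : ℝ) (k : ℤ) : 0 ≤ profile p t k :=
  mul_nonneg (decay_pos t k).le (Real.rpow_nonneg (abs_nonneg _) _)

theorem profile_zero (p : ℕ) (t : ℝ) : profile p t 0 = 0 := by
  have : -((p : ℝ) + 7 / 4) ≠ 0 := by
    have := Nat.cast_nonneg (α := ℝ) p
    linarith
  rw [profile, Int.cast_zero, abs_zero, Real.zero_rpow this, mul_zero]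

theorem profile_pos (p : ℕ) (t : ℝ) {k : ℤ} (hk : k ≠ 0) : 0 < profile p t k :=
  mul_pos (decay_pos t k) (Real.rpow_pos_of_pos (abs_pos.2 (Int.cast_ne_zero.2 hk)) _)

theorem profile_neg (p : ℕ) (t : ℝ) (k : ℤ) : profile p t (-k) = profile p t k := by
  simp [profile, decay_neg]

theorem continuous_profile (p : ℕ) (k : ℤ) : Continuous fun t => profile p t k :=
  (continuous_decay k).mul continuous_const

theorem pow_mul_profile_le (p : ℕ) (t : ℝ) (k : ℤ) :
    |(k : ℝ)| ^ (p + 1) * profile p t k ≤ |(k : ℝ)| ^ (-(3 / 4) : ℝ) * decay t k := by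
  rcases eq_or_ne k 0 with rfl | hk
  · rw [profile_zero, mul_zero]
    exact mul_nonneg (Real.rpow_nonneg (abs_nonneg _) _) (decay_pos _ _).le
  · have hk0 : 0 < |(k : ℝ)| := abs_pos.2 (Int.cast_ne_zero.2 hk)
    have : |(k : ℝ)| ^ (p + 1) * |(k : ℝ)| ^ (-((p : ℝ) + 7 / 4)) =
        |(k : ℝ)| ^ (-(3 / 4) : ℝ) := by
      rw [← Real.rpow_natCast, ← Real.rpow_add hk0]
      congr 1
      push_cast
      ring
    rw [profile, mul_left_comm, this, mul_comm]

/-- The Fourier coefficients at time `t` of the linear evolution of `c`, perturbed by the scaled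
unknown `y`. -/
def ansatz (ν : ℝ) (p : ℕ) (c : ℤ → ℂ) (t : ℝ) (y : ℤ → ℂ) (k : ℤ) : ℂ :=
  Real.exp (-((ν * k) ^ 4 * t)) • c k + profile p t k • y k

/-- A sequence in `ℓ²` that dominates the weighted coefficients `|k|^{p+1} exp (|k| t^{1/4}) a_k` of
`ansatz`. -/
def majorant (K : ℝ) (p : ℕ) (c : ℤ → ℂ) (k : ℤ) : ℝ :=
  K * (|(k : ℝ)| ^ (p + 1) * ‖c k‖) + |(k : ℝ)| ^ (-(3 / 4) : ℝ)

theorem majorant_nonneg {K : ℝ} (hK : 0 ≤ K) (p : ℕ) (c : ℤ → ℂ) (k : ℤ) :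
    0 ≤ majorant K p c k := by
  have := Real.rpow_nonneg (abs_nonneg (k : ℝ)) (-(3 / 4))
  unfold majorant
  positivity

theorem summable_majorant_sq (K : ℝ) {p : ℕ} {c : ℤ → ℂ}
    (hc : Summable fun k : ℤ => |(k : ℝ)| ^ (2 * (p + 1)) * ‖c k‖ ^ 2) :
    Summable fun k => majorant K p c k ^ 2 := by
  have h1 : Summable fun k : ℤ => |(k : ℝ)| ^ (-(3 / 2) : ℝ) :=
    Real.summable_abs_int_rpow (by norm_num)
  refine Summable.of_nonneg_of_le (fun k => sq_nonneg _) (fun k => ?_)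
    ((hc.mul_left (2 * K ^ 2)).add (h1.mul_left 2))
  have h2 : |(k : ℝ)| ^ (-(3 / 2) : ℝ) = (|(k : ℝ)| ^ (-(3 / 4) : ℝ)) ^ 2 := by
    rw [← Real.rpow_natCast, ← Real.rpow_mul (abs_nonneg _)]
    norm_num
  have h3 : |(k : ℝ)| ^ (2 * (p + 1)) * ‖c k‖ ^ 2 = (|(k : ℝ)| ^ (p + 1) * ‖c k‖) ^ 2 := by ring
  rw [h2, h3, majorant]
  nlinarith [sq_nonneg (K * (|(k : ℝ)| ^ (p + 1) * ‖c k‖) - |(k : ℝ)| ^ (-(3 / 4) : ℝ))]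

/-- The nonlinear term of the equation for the `k`-th Fourier coefficient. -/
def quadratic (ν : ℝ) (a : ℤ → ℂ) (k : ℤ) : ℂ := (-(ν ^ 4 * (k : ℝ) ^ 2)) • derivConv a a k

theorem quadratic_zero (ν : ℝ) (a : ℤ → ℂ) : quadratic ν a 0 = 0 := by simp [quadratic]

theorem quadratic_neg_eq_conj (ν : ℝ) {a : ℤ → ℂ} (ha : ∀ k, a (-k) = starRingEnd ℂ (a k))
    (k : ℤ) : quadratic ν a (-k) = starRingEnd ℂ (quadratic ν a k) := by
  simp [quadratic, derivConv_neg_eq_conj ha, Complex.real_smul]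

theorem ansatz_neg_eq_conj {ν : ℝ} {p : ℕ} {c : ℤ → ℂ} (hc : ∀ k, c (-k) = starRingEnd ℂ (c k))
    {y : ℤ → ℂ} (hy : ∀ k, y (-k) = starRingEnd ℂ (y k)) (t : ℝ) (k : ℤ) :
    ansatz ν p c t y (-k) = starRingEnd ℂ (ansatz ν p c t y k) := by
  have h : (ν * ((-k : ℤ) : ℝ)) ^ 4 = (ν * k) ^ 4 := by push_cast; ring
  simp only [ansatz, hc, hy, profile_neg, h, map_add, Complex.real_smul, map_mul,
    Complex.conj_ofReal]

section Bounds

variable {ν K : ℝ} {p : ℕ} {c : ℤ → ℂ} {t D E : ℝ} {y z : ℤ → ℂ}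

theorem pow_mul_norm_smul_profile_le (hK0 : 0 ≤ K) (hy : ∀ k, ‖y k‖ ≤ D) (k : ℤ) :
    |(k : ℝ)| ^ (p + 1) * ‖profile p t k • y k‖ ≤ D * majorant K p c k * decay t k := by
  have hD : 0 ≤ D := (norm_nonneg _).trans (hy k)
  have hd := decay_pos t k
  rw [norm_smul, Real.norm_eq_abs, abs_of_nonneg (profile_nonneg p t k), ← mul_assoc]
  calc |(k : ℝ)| ^ (p + 1) * profile p t k * ‖y k‖
      ≤ (|(k : ℝ)| ^ (-(3 / 4) : ℝ) * decay t k) * D :=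
        mul_le_mul (pow_mul_profile_le p t k) (hy k) (norm_nonneg _)
          (mul_nonneg (Real.rpow_nonneg (abs_nonneg _) _) hd.le)
    _ = D * |(k : ℝ)| ^ (-(3 / 4) : ℝ) * decay t k := by ring
    _ ≤ _ := by
        gcongr
        exact le_add_of_nonneg_left (by positivity)

theorem pow_mul_norm_ansatz_le (hK0 : 0 ≤ K)
    (hK : ∀ (k : ℤ) (r : ℝ), 0 ≤ r → Real.exp (-((ν * k) ^ 4 * r)) ≤
      K * (decay r k * Real.exp (-((ν * k) ^ 4 / 2 * r))))
    (ht : 0 ≤ t) (hy : ∀ k, ‖y k‖ ≤ D) (k : ℤ) :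
    |(k : ℝ)| ^ (p + 1) * ‖ansatz ν p c t y k‖ ≤
      (1 + D) * majorant K p c k * decay t k := by
  have hd := decay_pos t k
  have h1 : Real.exp (-((ν * k) ^ 4 * t)) ≤ K * decay t k := by
    refine (hK k t ht).trans (mul_le_mul_of_nonneg_left ?_ hK0)
    refine mul_le_of_le_one_right hd.le ?_
    rw [Real.exp_le_one_iff, neg_nonpos]
    positivity
  have h2 : |(k : ℝ)| ^ (p + 1) * ‖Real.exp (-((ν * k) ^ 4 * t)) • c k‖ ≤
      majorant K p c k * decay t k := by
    rw [norm_smul, Real.norm_eq_abs, abs_of_pos (Real.exp_pos _)]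
    calc |(k : ℝ)| ^ (p + 1) * (Real.exp (-((ν * k) ^ 4 * t)) * ‖c k‖)
        ≤ |(k : ℝ)| ^ (p + 1) * (K * decay t k * ‖c k‖) := by gcongr
      _ = K * (|(k : ℝ)| ^ (p + 1) * ‖c k‖) * decay t k := by ring
      _ ≤ _ := by
        gcongr
        exact le_add_of_nonneg_right (Real.rpow_nonneg (abs_nonneg _) _)
  have h3 := pow_mul_norm_smul_profile_le (p := p) (c := c) (t := t) hK0 hy k
  calc |(k : ℝ)| ^ (p + 1) * ‖ansatz ν p c t y k‖
      ≤ |(k : ℝ)| ^ (p + 1) * ‖Real.exp (-((ν * k) ^ 4 * t)) • c k‖ +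
          |(k : ℝ)| ^ (p + 1) * ‖profile p t k • y k‖ := by
        rw [← mul_add]
        gcongr
        exact norm_add_le _ _
    _ ≤ _ := by linarith

theorem ansatz_sub (t : ℝ) (y z : ℤ → ℂ) :
    ansatz ν p c t y - ansatz ν p c t z = fun k => profile p t k • (y - z) k := by
  funext k
  simp only [ansatz, Pi.sub_apply, smul_sub]
  ring

theorem norm_quadratic_sub_le (hK0 : 0 ≤ K)
    (hK : ∀ (k : ℤ) (r : ℝ), 0 ≤ r → Real.exp (-((ν * k) ^ 4 * r)) ≤
      K * (decay r k * Real.exp (-((ν * k) ^ 4 / 2 * r))))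
    (hc : Summable fun k : ℤ => |(k : ℝ)| ^ (2 * (p + 1)) * ‖c k‖ ^ 2)
    (ht : 0 ≤ t) (hD : 0 ≤ D) (hy : ∀ k, ‖y k‖ ≤ D) (hz : ∀ k, ‖z k‖ ≤ D)
    (hyz : ∀ k, ‖(y - z) k‖ ≤ E) (k : ℤ) :
    |(k : ℝ)| ^ p * ‖quadratic ν (ansatz ν p c t y) k - quadratic ν (ansatz ν p c t z) k‖ ≤
      ν ^ 4 * (k : ℝ) ^ 2 * (2 ^ (p + 1) * (1 + D) * E * (∑' j, majorant K p c j ^ 2)) *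
        decay t k := by
  have hE : 0 ≤ E := (norm_nonneg _).trans (hyz k)
  have hW := majorant_nonneg hK0 p c
  have hW2 := summable_majorant_sq K hc
  have ha := pow_mul_norm_ansatz_le (p := p) (c := c) hK0 hK ht hy
  have hb := pow_mul_norm_ansatz_le (p := p) (c := c) hK0 hK ht hz
  have hab : ∀ k : ℤ, |(k : ℝ)| ^ (p + 1) * ‖(ansatz ν p c t y - ansatz ν p c t z) k‖ ≤
      E * majorant K p c k * decay t k := by
    rw [ansatz_sub]
    exact pow_mul_norm_smul_profile_le hK0 hyz
  have h1 := pow_mul_norm_derivConv_le ht hE (by linarith) hW hW2 hab ha k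
  have h2 := pow_mul_norm_derivConv_le ht (by linarith) hE hW hW2 hb hab k
  rw [quadratic, quadratic, ← smul_sub, derivConv_self_sub ht hW2 ha hb hab, norm_smul,
    Real.norm_eq_abs, abs_neg,
    abs_of_nonneg (by positivity : 0 ≤ ν ^ 4 * (k : ℝ) ^ 2)]
  set u := derivConv (ansatz ν p c t y - ansatz ν p c t z) (ansatz ν p c t y) k
  set v := derivConv (ansatz ν p c t z) (ansatz ν p c t y - ansatz ν p c t z) k
  have h3 : |(k : ℝ)| ^ p * ‖u + v‖ ≤ |(k : ℝ)| ^ p * ‖u‖ + |(k : ℝ)| ^ p * ‖v‖ := by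
    rw [← mul_add]
    gcongr
    exact norm_add_le _ _
  calc |(k : ℝ)| ^ p * (ν ^ 4 * (k : ℝ) ^ 2 * ‖u + v‖)
      = ν ^ 4 * (k : ℝ) ^ 2 * (|(k : ℝ)| ^ p * ‖u + v‖) := by ring
    _ ≤ ν ^ 4 * (k : ℝ) ^ 2 *
        (2 ^ p * (E * (1 + D)) * (∑' j, majorant K p c j ^ 2) * decay t k +
          2 ^ p * ((1 + D) * E) * (∑' j, majorant K p c j ^ 2) * decay t k) := by
        gcongr
        linarith
    _ = _ := by ring

theorem norm_quadratic_le (hK0 : 0 ≤ K)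
    (hK : ∀ (k : ℤ) (r : ℝ), 0 ≤ r → Real.exp (-((ν * k) ^ 4 * r)) ≤
      K * (decay r k * Real.exp (-((ν * k) ^ 4 / 2 * r))))
    (hc : Summable fun k : ℤ => |(k : ℝ)| ^ (2 * (p + 1)) * ‖c k‖ ^ 2)
    (ht : 0 ≤ t) (hD : 0 ≤ D) (hy : ∀ k, ‖y k‖ ≤ D) (k : ℤ) :
    |(k : ℝ)| ^ p * ‖quadratic ν (ansatz ν p c t y) k‖ ≤
      ν ^ 4 * (k : ℝ) ^ 2 * (2 ^ p * (1 + D) ^ 2 * (∑' j, majorant K p c j ^ 2)) *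
        decay t k := by
  have hW := majorant_nonneg hK0 p c
  have hW2 := summable_majorant_sq K hc
  have ha := pow_mul_norm_ansatz_le (p := p) (c := c) hK0 hK ht hy
  have h1 := pow_mul_norm_derivConv_le ht (by linarith) (by linarith) hW hW2 ha ha k
  rw [quadratic, norm_smul, Real.norm_eq_abs, abs_neg,
    abs_of_nonneg (by positivity : 0 ≤ ν ^ 4 * (k : ℝ) ^ 2)]
  calc |(k : ℝ)| ^ p * (ν ^ 4 * (k : ℝ) ^ 2 * ‖derivConv _ _ k‖)
      = ν ^ 4 * (k : ℝ) ^ 2 * (|(k : ℝ)| ^ p *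
        ‖derivConv (ansatz ν p c t y) (ansatz ν p c t y) k‖) := by ring
    _ ≤ ν ^ 4 * (k : ℝ) ^ 2 *
        (2 ^ p * ((1 + D) * (1 + D)) * (∑' j, majorant K p c j ^ 2) * decay t k) := by
        gcongr
    _ = _ := by ring

/-- Duhamel's integral of a forcing term of the size of the nonlinearity, in units of `profile`. -/
theorem norm_profile_inv_smul_duhamel_le {δ G : ℝ} (hν : 0 < ν) (hK0 : 0 ≤ K)
    (hK : ∀ (k : ℤ) (r : ℝ), 0 ≤ r → Real.exp (-((ν * k) ^ 4 * r)) ≤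
      K * (decay r k * Real.exp (-((ν * k) ^ 4 / 2 * r))))
    (hδ : 0 < δ) (ht : 0 ≤ t) (htδ : t ≤ δ ^ 16) (hG : 0 ≤ G) (k : ℤ) {f : ℝ → ℂ}
    (hf : ∀ s ∈ Icc 0 t, |(k : ℝ)| ^ p * ‖f s‖ ≤ ν ^ 4 * (k : ℝ) ^ 2 * G * decay s k) :
    ‖(profile p t k)⁻¹ • duhamel ν k f t‖ ≤ K * (ν ^ 4 + 2) * δ * G := by
  rcases eq_or_ne k 0 with rfl | hk
  · rw [profile_zero, inv_zero, zero_smul, norm_zero]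
    positivity
  have hk0 : 0 < |(k : ℝ)| := abs_pos.2 (Int.cast_ne_zero.2 hk)
  have hkp : 0 < |(k : ℝ)| ^ p := by positivity
  set F : ℝ := ν ^ 4 * (k : ℝ) ^ 2 * G / |(k : ℝ)| ^ p with hFdef
  have hF : 0 ≤ F := by positivity
  have hf' : ∀ s ∈ Icc 0 t, ‖f s‖ ≤ F * decay s k := by
    intro s hs
    rw [hFdef, div_mul_eq_mul_div, le_div_iff₀ hkp, mul_comm]
    exact hf s hs
  have h1 := norm_duhamel_le hν hk hK0 (hK k) ht hF hf'
  have hpr := profile_pos p t hk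
  have hd := decay_pos t k
  rw [norm_smul, norm_inv, Real.norm_eq_abs, abs_of_pos hpr, inv_mul_le_iff₀ hpr]
  refine h1.trans ?_
  have hgain := rpow_mul_min_le hν hk hδ htδ
  have hpow : (k : ℝ) ^ 2 / |(k : ℝ)| ^ p =
      |(k : ℝ)| ^ (-((p : ℝ) + 7 / 4)) * |(k : ℝ)| ^ (15 / 4 : ℝ) := by
    rw [← sq_abs, ← Real.rpow_natCast, ← Real.rpow_natCast, ← Real.rpow_sub hk0,
      ← Real.rpow_add hk0]
    congr 1
    push_cast
    ring
  have hr := Real.rpow_nonneg (abs_nonneg (k : ℝ)) (-((p : ℝ) + 7 / 4))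
  calc F * K * decay t k * min t (2 / (ν * k) ^ 4)
      = ν ^ 4 * G * K * decay t k * ((k : ℝ) ^ 2 / |(k : ℝ)| ^ p) *
          min t (2 / (ν * k) ^ 4) := by
        rw [hFdef]
        ring
    _ = ν ^ 4 * G * K * profile p t k *
          (|(k : ℝ)| ^ (15 / 4 : ℝ) * min t (2 / (ν * k) ^ 4)) := by
        rw [hpow, profile]
        ring
    _ ≤ ν ^ 4 * G * K * profile p t k * ((1 + 2 / ν ^ 4) * δ) := by
        gcongr
    _ = profile p t k * (K * (ν ^ 4 + 2) * δ * G) := by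
        field_simp

end Bounds

/-! ### Existence of the Fourier coefficients of the solution -/

section FixedPoint

variable {ν K : ℝ} {p : ℕ} {c : ℤ → ℂ} {T D : ℝ}

/-- The nonlinear term along the path of coefficients given by the scaled unknown `y`. -/
def forcing (ν : ℝ) (p : ℕ) (c : ℤ → ℂ) (T : ℝ) (y : ℤ → ℝ → ℂ) (k : ℤ) (s : ℝ) : ℂ :=
  quadratic ν (ansatz ν p c (clamp T s) fun j => y j s) k

/-- The right hand side of the fixed point equation for the scaled unknown. For `k = 0` it vanishes,
since `profile` does and `0⁻¹ = 0`; the mean value is conserved, so nothing is lost. -/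
def duhamelMap (ν : ℝ) (p : ℕ) (c : ℤ → ℂ) (T : ℝ) (y : ℤ → ℝ → ℂ) (k : ℤ) (t : ℝ) : ℂ :=
  (profile p (clamp T t) k)⁻¹ • duhamel ν k (forcing ν p c T y k) (clamp T t)

theorem continuous_ansatz {y : ℤ → ℝ → ℂ} (hy : ∀ k, Continuous (y k)) (k : ℤ) :
    Continuous fun s => ansatz ν p c (clamp T s) (fun j => y j s) k := by
  have h1 := continuous_clamp T
  have h2 := (continuous_profile p k).comp h1
  have h3 := hy k
  simp only [Function.comp_def] at h2
  unfold ansatz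
  fun_prop

theorem continuous_forcing (hν : 0 < ν)
    (hc : Summable fun k : ℤ => |(k : ℝ)| ^ (2 * (p + 1)) * ‖c k‖ ^ 2)
    {y : ℤ → ℝ → ℂ} (hy : ∀ k, Continuous (y k)) (hD : ∀ k t, ‖y k t‖ ≤ D) (k : ℤ) :
    Continuous (forcing ν p c T y k) := by
  obtain ⟨K, hK1, hK⟩ := exists_heat_le hν
  have hK0 : 0 ≤ K := zero_le_one.trans hK1
  have ha := fun s => pow_mul_norm_ansatz_le (p := p) (c := c) (t := clamp T s) hK0 hK
    (clamp_nonneg T s) (fun j => hD j s)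
  have hcont : Continuous fun s => derivConv (ansatz ν p c (clamp T s) fun j => y j s)
      (ansatz ν p c (clamp T s) fun j => y j s) k := by
    unfold derivConv
    refine continuous_tsum (fun j => ?_)
      ((summable_mul_sub (summable_majorant_sq K hc) k).mul_left ((1 + D) * (1 + D)))
      fun j s => norm_derivConv_term_le (clamp_nonneg T s) (ha s) (ha s) j (k - j)
    exact (continuous_const.mul (continuous_ansatz hy j)).mul
      (continuous_const.mul (continuous_ansatz hy (k - j)))
  exact Continuous.const_smul hcont (-(ν ^ 4 * (k : ℝ) ^ 2))

theorem continuous_duhamelMap (hν : 0 < ν)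
    (hc : Summable fun k : ℤ => |(k : ℝ)| ^ (2 * (p + 1)) * ‖c k‖ ^ 2)
    {y : ℤ → ℝ → ℂ} (hy : ∀ k, Continuous (y k)) (hD : ∀ k t, ‖y k t‖ ≤ D) (k : ℤ) :
    Continuous (duhamelMap ν p c T y k) := by
  have h1 : Continuous fun t => duhamel ν k (forcing ν p c T y k) (clamp T t) :=
    (continuous_duhamel ν k (continuous_forcing hν hc hy hD k)).comp (continuous_clamp T)
  unfold duhamelMap
  rcases eq_or_ne k 0 with rfl | hk
  · simp only [profile_zero, inv_zero, zero_smul]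
    exact continuous_const
  · exact (((continuous_profile p k).comp (continuous_clamp T)).inv₀
      fun t => (profile_pos p _ hk).ne').smul h1

theorem norm_duhamelMap_le {δ : ℝ} (hν : 0 < ν) (hK0 : 0 ≤ K)
    (hK : ∀ (k : ℤ) (r : ℝ), 0 ≤ r → Real.exp (-((ν * k) ^ 4 * r)) ≤
      K * (decay r k * Real.exp (-((ν * k) ^ 4 / 2 * r))))
    (hc : Summable fun k : ℤ => |(k : ℝ)| ^ (2 * (p + 1)) * ‖c k‖ ^ 2) (hδ : 0 < δ)
    {y : ℤ → ℝ → ℂ} (hD0 : 0 ≤ D) (hD : ∀ k t, ‖y k t‖ ≤ D) (k : ℤ) (t : ℝ) :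
    ‖duhamelMap ν p c (δ ^ 16) y k t‖ ≤
      K * (ν ^ 4 + 2) * δ * (2 ^ p * (1 + D) ^ 2 * (∑' j, majorant K p c j ^ 2)) := by
  refine norm_profile_inv_smul_duhamel_le hν hK0 hK hδ (clamp_nonneg _ _)
    (clamp_le (by positivity) t) ?_ k fun s hs => ?_
  · have : 0 ≤ ∑' j, majorant K p c j ^ 2 := tsum_nonneg fun j => sq_nonneg _
    positivity
  · have hs' : s ∈ Icc 0 (δ ^ 16) := ⟨hs.1, hs.2.trans (clamp_le (by positivity) t)⟩
    unfold forcing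
    rw [clamp_of_mem hs']
    exact norm_quadratic_le hK0 hK hc hs.1 hD0 (fun j => hD j s) k

theorem norm_duhamelMap_sub_le {δ E : ℝ} (hν : 0 < ν) (hK0 : 0 ≤ K)
    (hK : ∀ (k : ℤ) (r : ℝ), 0 ≤ r → Real.exp (-((ν * k) ^ 4 * r)) ≤
      K * (decay r k * Real.exp (-((ν * k) ^ 4 / 2 * r))))
    (hc : Summable fun k : ℤ => |(k : ℝ)| ^ (2 * (p + 1)) * ‖c k‖ ^ 2) (hδ : 0 < δ)
    {y z : ℤ → ℝ → ℂ} (hyc : ∀ k, Continuous (y k)) (hzc : ∀ k, Continuous (z k))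
    (hy : ∀ k t, ‖y k t‖ ≤ D) (hz : ∀ k t, ‖z k t‖ ≤ D)
    (hyz : ∀ k t, ‖y k t - z k t‖ ≤ E) (k : ℤ) (t : ℝ) :
    ‖duhamelMap ν p c (δ ^ 16) y k t - duhamelMap ν p c (δ ^ 16) z k t‖ ≤
      K * (ν ^ 4 + 2) * δ *
        (2 ^ (p + 1) * (1 + D) * E * (∑' j, majorant K p c j ^ 2)) := by
  have hD0 : 0 ≤ D := (norm_nonneg _).trans (hy 0 0)
  have hE0 : 0 ≤ E := (norm_nonneg _).trans (hyz 0 0)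
  unfold duhamelMap
  rw [← smul_sub, ← duhamel_sub ν k (continuous_forcing hν hc hyc hy k)
    (continuous_forcing hν hc hzc hz k)]
  refine norm_profile_inv_smul_duhamel_le hν hK0 hK hδ (clamp_nonneg _ _)
    (clamp_le (by positivity) t) ?_ k fun s hs => ?_
  · have : 0 ≤ ∑' j, majorant K p c j ^ 2 := tsum_nonneg fun j => sq_nonneg _
    positivity
  · have hs' : s ∈ Icc 0 (δ ^ 16) := ⟨hs.1, hs.2.trans (clamp_le (by positivity) t)⟩
    simp only [Pi.sub_apply, forcing]
    rw [clamp_of_mem hs']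
    exact norm_quadratic_sub_le hK0 hK hc hs.1 hD0 (fun j => hy j s) (fun j => hz j s)
      (fun j => hyz j s) k

theorem duhamelMap_neg_eq_conj (hc : ∀ k, c (-k) = starRingEnd ℂ (c k)) {y : ℤ → ℝ → ℂ}
    (hy : ∀ k t, y (-k) t = starRingEnd ℂ (y k t)) (k : ℤ) (t : ℝ) :
    duhamelMap ν p c T y (-k) t = starRingEnd ℂ (duhamelMap ν p c T y k t) := by
  have h : forcing ν p c T y (-k) = fun s => starRingEnd ℂ (forcing ν p c T y k s) := by
    funext s
    exact quadratic_neg_eq_conj ν (ansatz_neg_eq_conj hc (fun j => hy j s) _) k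
  rw [duhamelMap, h, duhamel_neg_conj, profile_neg, duhamelMap]
  simp only [Complex.real_smul, map_mul, Complex.conj_ofReal]

/-- For a short time interval the fixed point equation is solved by Banach's theorem in the unit
ball of the bounded continuous functions on `ℤ × ℝ` that have the symmetry of the Fourier
coefficients of real functions. -/
theorem exists_eq_duhamelMap (hν : 0 < ν)
    (hc : Summable fun k : ℤ => |(k : ℝ)| ^ (2 * (p + 1)) * ‖c k‖ ^ 2)
    (hsymm : ∀ k, c (-k) = starRingEnd ℂ (c k)) :
    ∃ T : ℝ, 0 < T ∧ ∃ y : ℤ → ℝ → ℂ, (∀ k, Continuous (y k)) ∧ (∀ k t, ‖y k t‖ ≤ 1) ∧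
      (∀ k t, y (-k) t = starRingEnd ℂ (y k t)) ∧
      ∀ k t, y k t = duhamelMap ν p c T y k t := by
  obtain ⟨K, hK1, hK⟩ := exists_heat_le hν
  have hK0 : 0 ≤ K := zero_le_one.trans hK1
  have hS0 : 0 ≤ ∑' j, majorant K p c j ^ 2 := tsum_nonneg fun j => sq_nonneg _
  set C : ℝ := K * (ν ^ 4 + 2) * (2 ^ (p + 2) * ∑' j, majorant K p c j ^ 2) with hC
  have hC0 : 0 ≤ C := by positivity
  -- `C * δ` bounds both the image of the unit ball and the Lipschitz constant on it
  set δ : ℝ := 1 / (2 * C + 1) with hδdef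
  have hδ : 0 < δ := by positivity
  have hCδ : C * δ ≤ 1 / 2 := by
    rw [hδdef, mul_one_div, div_le_iff₀ (by positivity)]
    linarith
  have hcomp : ∀ (y : BoundedContinuousFunction (ℤ × ℝ) ℂ) (k : ℤ),
      Continuous fun t => y (k, t) := fun y k => by fun_prop
  have hbd : ∀ (y : BoundedContinuousFunction (ℤ × ℝ) ℂ) (k : ℤ) (t : ℝ),
      ‖y (k, t)‖ ≤ ‖y‖ := fun y k t => y.norm_coe_le_norm _
  have hcont : ∀ y : BoundedContinuousFunction (ℤ × ℝ) ℂ, Continuous fun q : ℤ × ℝ =>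
      duhamelMap ν p c (δ ^ 16) (fun k t => y (k, t)) q.1 q.2 := by
    intro y
    rw [continuous_prod_of_discrete_left]
    intro k
    exact continuous_duhamelMap (T := δ ^ 16) (y := fun k t => y (k, t)) hν hc (hcomp y) (hbd y) k
  let Φ : BoundedContinuousFunction (ℤ × ℝ) ℂ → BoundedContinuousFunction (ℤ × ℝ) ℂ := fun y =>
    BoundedContinuousFunction.ofNormedAddCommGroup
      (fun q : ℤ × ℝ => duhamelMap ν p c (δ ^ 16) (fun k t => y (k, t)) q.1 q.2)
      (hcont y) _ fun q => norm_duhamelMap_le hν hK0 hK hc hδ (norm_nonneg y) (hbd y) q.1 q.2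
  have hΦ : ∀ y k t, Φ y (k, t) = duhamelMap ν p c (δ ^ 16) (fun k t => y (k, t)) k t :=
    fun y k t => rfl
  let S : Set (BoundedContinuousFunction (ℤ × ℝ) ℂ) :=
    {y | ‖y‖ ≤ 1 ∧ ∀ k t, y (-k, t) = starRingEnd ℂ (y (k, t))}
  have hS : IsComplete S := by
    refine IsClosed.isComplete ?_
    have h1 : IsClosed {y : BoundedContinuousFunction (ℤ × ℝ) ℂ | ‖y‖ ≤ 1} :=
      isClosed_le continuous_norm continuous_const
    have h2 : IsClosed {y : BoundedContinuousFunction (ℤ × ℝ) ℂ |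
        ∀ k t, y (-k, t) = starRingEnd ℂ (y (k, t))} := by
      simp only [ofPred_forall]
      refine isClosed_iInter fun k => isClosed_iInter fun t => ?_
      exact isClosed_eq (BoundedContinuousFunction.lipschitz_eval_const _).continuous
        (Complex.continuous_conj.comp (BoundedContinuousFunction.lipschitz_eval_const _).continuous)
    exact h1.inter h2
  have hmaps : MapsTo Φ S S := by
    rintro y ⟨hy1, hy2⟩
    refine ⟨(BoundedContinuousFunction.norm_le zero_le_one).2 ?_, fun k t => ?_⟩
    · rintro ⟨k, t⟩
      rw [hΦ]
      refine (norm_duhamelMap_le hν hK0 hK hc hδ zero_le_one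
        (fun j s => (hbd y j s).trans hy1) k t).trans ?_
      have : K * (ν ^ 4 + 2) * δ * (2 ^ p * (1 + 1) ^ 2 * (∑' j, majorant K p c j ^ 2)) =
        C * δ := by rw [hC]; ring
      rw [this]
      linarith
    · rw [hΦ, hΦ]
      exact duhamelMap_neg_eq_conj hsymm hy2 k t
  have hcontr : ContractingWith (1 / 2) (hmaps.restrict Φ S S) := by
    refine ⟨by norm_num, LipschitzWith.of_dist_le_mul ?_⟩
    rintro ⟨y, hy1, hy2⟩ ⟨z, hz1, hz2⟩
    rw [Subtype.dist_eq, Subtype.dist_eq]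
    change dist (Φ y) (Φ z) ≤ _ * dist y z
    refine (BoundedContinuousFunction.dist_le (by positivity)).2 ?_
    rintro ⟨k, t⟩
    rw [hΦ, hΦ, dist_eq_norm]
    refine (norm_duhamelMap_sub_le (E := dist y z) hν hK0 hK hc hδ (hcomp y) (hcomp z)
      (fun j s => (hbd y j s).trans hy1) (fun j s => (hbd z j s).trans hz1)
      (fun j s => ?_) k t).trans ?_
    · rw [← dist_eq_norm]
      exact BoundedContinuousFunction.dist_coe_le_dist _
    · have : K * (ν ^ 4 + 2) * δ *
          (2 ^ (p + 1) * (1 + 1) * dist y z * (∑' j, majorant K p c j ^ 2)) =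
          C * δ * dist y z := by rw [hC]; ring
      rw [this]
      have h := mul_le_mul_of_nonneg_right hCδ (dist_nonneg (x := y) (y := z))
      refine h.trans (le_of_eq ?_)
      norm_num
  obtain ⟨y, hyS, hfix, -⟩ := ContractingWith.exists_fixedPoint' hS hmaps hcontr
    (x := 0) ⟨by simp, by simp⟩ (edist_ne_top _ _)
  refine ⟨δ ^ 16, by positivity, fun k t => y (k, t), hcomp y,
    fun k t => (hbd y k t).trans hyS.1, hyS.2, fun k t => ?_⟩
  rw [← hΦ, hfix]

end FixedPoint

/-- `a` solves the initial value problem `a_k' = -(ν k)⁴ a_k + quadratic ν a k`, `a_k(0) = c_k` for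
the Fourier coefficients on `(0, T)`, and it is the sum of the linear evolution and a term bounded
by `profile`. -/
structure IsCoeffSolution (ν : ℝ) (p : ℕ) (c : ℤ → ℂ) (T : ℝ) (a : ℤ → ℝ → ℂ) : Prop where
  continuous : ∀ k, Continuous (a k)
  initial : ∀ k, a k 0 = c k
  symm : ∀ k t, a (-k) t = starRingEnd ℂ (a k t)
  norm_le : ∀ k, ∀ t ∈ Icc 0 T,
    ‖a k t‖ ≤ Real.exp (-((ν * k) ^ 4 * t)) * ‖c k‖ + profile p t k
  continuous_quadratic : ∀ k, Continuous fun t => quadratic ν (fun j => a j t) k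
  hasDerivAt : ∀ k, ∀ t ∈ Ioo 0 T,
    HasDerivAt (a k) (-((ν * k) ^ 4) • a k t + quadratic ν (fun j => a j t) k) t

theorem exists_isCoeffSolution {ν : ℝ} (hν : 0 < ν) {p : ℕ} {c : ℤ → ℂ}
    (hc : Summable fun k : ℤ => |(k : ℝ)| ^ (2 * (p + 1)) * ‖c k‖ ^ 2)
    (hsymm : ∀ k, c (-k) = starRingEnd ℂ (c k)) :
    ∃ T : ℝ, 0 < T ∧ ∃ a : ℤ → ℝ → ℂ, IsCoeffSolution ν p c T a := by
  obtain ⟨T, hT, y, hyc, hy1, hys, hfix⟩ := exists_eq_duhamelMap (p := p) hν hc hsymm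
  have hmild : ∀ k t, profile p (clamp T t) k • y k t =
      duhamel ν k (forcing ν p c T y k) (clamp T t) := by
    intro k t
    rcases eq_or_ne k 0 with rfl | hk
    · have : forcing ν p c T y 0 = 0 := funext fun s => quadratic_zero _ _
      rw [profile_zero, zero_smul, this]
      simp [duhamel]
    · rw [hfix k t, duhamelMap, smul_inv_smul₀ (profile_pos p _ hk).ne']
  have h0 : clamp T 0 = 0 := clamp_of_mem ⟨le_rfl, hT.le⟩
  refine ⟨T, hT, fun k t => ansatz ν p c (clamp T t) (fun j => y j t) k,
    continuous_ansatz hyc, fun k => ?_, fun k t => ansatz_neg_eq_conj hsymm (fun j => hys j t) _ k,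
    fun k t ht => ?_, continuous_forcing hν hc hyc hy1, fun k t ht => ?_⟩
  · simp only [ansatz]
    rw [hmild, h0, duhamel_zero]
    simp
  · rw [clamp_of_mem ht]
    refine (norm_add_le _ _).trans ?_
    rw [norm_smul, norm_smul, Real.norm_eq_abs, Real.norm_eq_abs, abs_of_pos (Real.exp_pos _),
      abs_of_nonneg (profile_nonneg p t k)]
    gcongr
    exact mul_le_of_le_one_right (profile_nonneg p t k) (hy1 k t)
  · have hd := hasDerivAt_duhamel ν k
      (continuous_forcing (T := T) (p := p) hν hc hyc hy1 k) t
    have he : HasDerivAt (fun t : ℝ => Real.exp (-((ν * k) ^ 4 * t)))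
        (Real.exp (-((ν * k) ^ 4 * t)) * -((ν * k) ^ 4)) t := by
      have : HasDerivAt (fun t : ℝ => -((ν * k) ^ 4 * t)) (-((ν * k) ^ 4 * 1)) t :=
        ((hasDerivAt_id t).const_mul _).neg
      simpa using this.exp
    have hev : (fun t => ansatz ν p c (clamp T t) (fun j => y j t) k) =ᶠ[nhds t]
        fun t => Real.exp (-((ν * k) ^ 4 * t)) • c k + duhamel ν k (forcing ν p c T y k) t := by
      filter_upwards [Ioo_mem_nhds ht.1 ht.2] with s hs
      simp only [ansatz]
      rw [hmild, clamp_of_mem (Ioo_subset_Icc_self hs)]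
    refine HasDerivAt.congr_of_eventuallyEq ?_ hev
    refine ((he.smul_const (c k)).add hd).congr_deriv ?_
    have : ansatz ν p c (clamp T t) (fun j => y j t) k =
        Real.exp (-((ν * k) ^ 4 * t)) • c k + duhamel ν k (forcing ν p c T y k) t := hev.self_of_nhds
    simp only [this, forcing, Complex.real_smul]
    push_cast
    ring

/-! ### Real functions on the circle and their Fourier coefficients -/

section Fourier

variable {L : ℝ} [Fact (0 < L)]

theorem fourierCoeff_eq_of_hasSum {c : ℤ → ℂ} {f : C(AddCircle L, ℂ)}
    (hf : HasSum (fun k => c k • fourier k) f) (k : ℤ) : fourierCoeff f k = c k := by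
  have h1 : HasSum (fun j => c j • (fourierBasis (T := L)) j)
      (ContinuousMap.toLp (E := ℂ) 2 AddCircle.haarAddCircle ℂ f) := by
    have := (ContinuousMap.toLp (E := ℂ) 2 (AddCircle.haarAddCircle (T := L)) ℂ).hasSum hf
    refine this.congr_fun fun j => ?_
    simp [coe_fourierBasis, fourierLp]
  have h2 := (innerSL ℂ ((fourierBasis (T := L)) k)).hasSum h1
  have h3 : (fourierBasis (T := L)).repr
      (ContinuousMap.toLp (E := ℂ) 2 AddCircle.haarAddCircle ℂ f) k = fourierCoeff f k := by
    rw [fourierBasis_repr]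
    unfold fourierCoeff
    refine integral_congr_ae ?_
    filter_upwards [ContinuousMap.coeFn_toLp (E := ℂ) (p := 2) (𝕜 := ℂ)
      (AddCircle.haarAddCircle (T := L)) f] with x hx
    rw [hx]
  rw [← h3, HilbertBasis.repr_apply_apply]
  have h4 : HasSum (fun j => if j = k then c k else 0) (c k) := hasSum_ite_eq k (c k)
  refine h2.unique (h4.congr_fun fun j => ?_)
  have h5 := orthonormal_iff_ite.1 (fourierBasis (T := L)).orthonormal k j
  rw [innerSL_apply_apply, inner_smul_right, h5]
  rcases eq_or_ne j k with rfl | hj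
  · simp
  · simp [hj, hj.symm]

theorem fourierCoeff_congr_ae {f g : AddCircle L → ℂ}
    (h : f =ᵐ[AddCircle.haarAddCircle] g) (k : ℤ) : fourierCoeff f k = fourierCoeff g k := by
  unfold fourierCoeff
  refine integral_congr_ae ?_
  filter_upwards [h] with x hx
  rw [hx]

theorem coeff_neg (u : L2 L) (k : ℤ) : coeff u (-k) = starRingEnd ℂ (coeff u k) := by
  unfold coeff fourierCoeff
  rw [← integral_conj]
  refine integral_congr_ae (Filter.Eventually.of_forall fun x => ?_)
  simp only [smul_eq_mul, map_mul, Complex.conj_ofReal, fourier_neg, neg_neg, Complex.conj_conj]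

theorem eq_of_coeff {u v : L2 L} (h : ∀ k, coeff u k = coeff v k) : u = v := by
  rw [← sub_eq_zero]
  refine eq_zero_of_coeff _ fun k => ?_
  have h1 : u - v = u + (-1 : ℝ) • v := by rw [neg_one_smul, sub_eq_add_neg]
  rw [h1, coeff_add, coeff_smul, h k]
  simp

/-- An absolutely convergent Fourier series with the symmetry of real functions is the Fourier
series of a real function in `L²`, to which it converges almost everywhere. -/
theorem exists_coeff_eq {c : ℤ → ℂ} (hc : Summable fun k => ‖c k‖)
    (hsymm : ∀ k, c (-k) = starRingEnd ℂ (c k)) :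
    ∃ u : L2 L, (∀ k, coeff u k = c k) ∧
      ∀ᵐ x ∂(AddCircle.haarAddCircle : Measure (AddCircle L)),
        HasSum (fun k => c k * fourier k x) ((u x : ℝ) : ℂ) := by
  have hs : Summable fun k => c k • (fourier k : C(AddCircle L, ℂ)) := by
    refine Summable.of_norm_bounded hc fun k => ?_
    rw [norm_smul, fourier_norm, mul_one]
  obtain ⟨f, hf⟩ := hs
  have hfx : ∀ x, HasSum (fun k => c k * fourier k x) (f x) := fun x => by
    have := (ContinuousMap.evalCLM ℂ x).hasSum hf
    simpa [Function.comp_def] using this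
  have hreal : ∀ x, ((f x).re : ℂ) = f x := by
    intro x
    rw [← Complex.conj_eq_iff_re]
    have h1 : HasSum (fun k => starRingEnd ℂ (c k * fourier k x)) (starRingEnd ℂ (f x)) :=
      (Complex.conjCLE.toContinuousLinearMap).hasSum (hfx x)
    have h2 := (Equiv.neg ℤ).hasSum_iff.2 h1
    refine HasSum.unique ?_ (hfx x)
    convert h2 using 1
    funext k
    simp [hsymm]
  let g : C(AddCircle L, ℝ) := ⟨fun x => (f x).re, by fun_prop⟩
  have hg := ContinuousMap.coeFn_toLp (E := ℝ) (p := 2) (𝕜 := ℝ)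
    (AddCircle.haarAddCircle (T := L)) g
  refine ⟨ContinuousMap.toLp (E := ℝ) 2 AddCircle.haarAddCircle ℝ g, fun k => ?_, ?_⟩
  · rw [← fourierCoeff_eq_of_hasSum hf k]
    refine fourierCoeff_congr_ae ?_ k
    filter_upwards [hg] with x hx
    rw [hx]
    exact hreal x
  · filter_upwards [hg] with x hx
    rw [hx]
    have : ((g x : ℝ) : ℂ) = f x := hreal x
    rw [this]
    exact hfx x

/-- Almost everywhere convergence of the Fourier series of an element of `L²` with absolutely
summable Fourier coefficients. -/
theorem ae_hasSum_of_summable_coeff {u : L2 L} (hu : Summable fun k => ‖coeff u k‖) :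
    ∀ᵐ x ∂(AddCircle.haarAddCircle : Measure (AddCircle L)),
      HasSum (fun k => coeff u k * fourier k x) ((u x : ℝ) : ℂ) := by
  obtain ⟨v, hv, hv'⟩ := exists_coeff_eq (L := L) hu (coeff_neg u)
  rwa [eq_of_coeff hv] at hv'

theorem abs_rpow_two_mul {s : ℝ} {m : ℕ} (hs : s = m) (k : ℤ) :
    |(k : ℝ)| ^ (2 * s) = |(k : ℝ)| ^ (2 * m) := by
  rw [hs, ← Real.rpow_natCast]
  push_cast
  rfl

theorem HDot.norm_sub_sq_eq {s : ℝ} (u v : HDot L s) :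
    ‖u - v‖ ^ 2 = ∑' k : ℤ, |(k : ℝ)| ^ (2 * s) *
      ‖coeff (HDot.toL2 u) k - coeff (HDot.toL2 v) k‖ ^ 2 := by
  rw [HDot.norm_sq_eq]
  refine tsum_congr fun k => ?_
  have h1 : HDot.toL2 (u - v) = HDot.toL2 u + (-1 : ℝ) • HDot.toL2 v := by
    rw [neg_one_smul, map_sub, sub_eq_add_neg]
  rw [h1, coeff_add, coeff_smul]
  congr 3
  push_cast
  ring

/-- A path in `Ḣ^s` whose Fourier coefficients are continuous and dominated is continuous. -/
theorem HDot.continuousOn_of_coeff {s : ℝ} {u : ℝ → HDot L s} {S : Set ℝ} {D : ℤ → ℝ}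
    (hD : Summable D)
    (hbound : ∀ t ∈ S, ∀ k : ℤ, |(k : ℝ)| ^ (2 * s) * ‖coeff (HDot.toL2 (u t)) k‖ ^ 2 ≤ D k)
    (hcont : ∀ k, ContinuousOn (fun t => coeff (HDot.toL2 (u t)) k) S) : ContinuousOn u S := by
  intro t₀ ht₀
  rw [ContinuousWithinAt, tendsto_iff_norm_sub_tendsto_zero]
  have h1 : Filter.Tendsto (fun t => ‖u t - u t₀‖ ^ 2) (nhdsWithin t₀ S) (nhds 0) := by
    simp only [HDot.norm_sub_sq_eq]
    rw [← tsum_zero (α := ℝ) (β := ℤ)]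
    refine tendsto_tsum_of_dominated_convergence (hD.mul_left 4) (fun k => ?_) ?_
    · have h2 := ((hcont k t₀ ht₀).tendsto.sub_const
        (coeff (HDot.toL2 (u t₀)) k)).norm.pow 2 |>.const_mul (|(k : ℝ)| ^ (2 * s))
      simpa using h2
    · filter_upwards [self_mem_nhdsWithin] with t ht k
      have hk : 0 ≤ |(k : ℝ)| ^ (2 * s) := Real.rpow_nonneg (abs_nonneg _) _
      rw [Real.norm_eq_abs, abs_of_nonneg (by positivity)]
      have h3 : ‖coeff (HDot.toL2 (u t)) k - coeff (HDot.toL2 (u t₀)) k‖ ^ 2 ≤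
          2 * ‖coeff (HDot.toL2 (u t)) k‖ ^ 2 + 2 * ‖coeff (HDot.toL2 (u t₀)) k‖ ^ 2 := by
        have := norm_sub_le (coeff (HDot.toL2 (u t)) k) (coeff (HDot.toL2 (u t₀)) k)
        have h4 := pow_le_pow_left₀ (norm_nonneg _) this 2
        nlinarith [sq_nonneg (‖coeff (HDot.toL2 (u t)) k‖ - ‖coeff (HDot.toL2 (u t₀)) k‖)]
      have h5 := mul_le_mul_of_nonneg_left h3 hk
      linarith [hbound t ht k, hbound t₀ ht₀ k]
  have h2 := h1.sqrt
  simpa [Real.sqrt_sq (norm_nonneg _)] using h2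

theorem HDot.exists_coeff_eq {s : ℝ} {m : ℕ} (hs : s = m) {c : ℤ → ℂ}
    (hc : Summable fun k => ‖c k‖) (hsymm : ∀ k, c (-k) = starRingEnd ℂ (c k)) (hc0 : c 0 = 0)
    (hcm : Summable fun k : ℤ => |(k : ℝ)| ^ (2 * m) * ‖c k‖ ^ 2) :
    ∃ u : HDot L s, ∀ k, coeff (HDot.toL2 u) k = c k := by
  obtain ⟨u, hu, -⟩ := SurfaceGrowth.exists_coeff_eq (L := L) hc hsymm
  have hmem : u ∈ hdotSubmodule L s := by
    refine ⟨by rw [hu, hc0], hcm.congr fun k => ?_⟩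
    rw [abs_rpow_two_mul hs, hu]
  exact ⟨(⟨u, hmem⟩ : hdotSubmodule L s), hu⟩

theorem HDot.eq_of_coeff {s : ℝ} {u v : HDot L s}
    (h : ∀ k, coeff (HDot.toL2 u) k = coeff (HDot.toL2 v) k) : u = v :=
  Subtype.ext (SurfaceGrowth.eq_of_coeff h)

end Fourier

/-! ### Decay estimates -/

theorem decay_eq_sq {τ : ℝ} (hτ : 0 ≤ τ) (k : ℤ) : decay τ k = decay (τ / 16) k ^ 2 := by
  have h1 : (τ / 16) ^ (1 / 4 : ℝ) = τ ^ (1 / 4 : ℝ) / 2 := by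
    have h16 : (16 : ℝ) = 2 ^ (4 : ℝ) := by norm_num
    rw [Real.div_rpow hτ (by norm_num), h16, ← Real.rpow_mul (by norm_num)]
    norm_num
  rw [decay, decay, h1, ← Real.exp_nat_mul]
  congr 1
  push_cast
  ring

theorem summable_pow_mul_decay {t : ℝ} (ht : 0 < t) (m : ℕ) :
    Summable fun k : ℤ => |(k : ℝ)| ^ m * decay t k := by
  have hr : 0 < t ^ (1 / 4 : ℝ) := Real.rpow_pos_of_pos ht _
  have h1 : Summable fun k : ℕ => (k : ℝ) ^ m * decay t k := by
    have := summable_pow_mul_geometric_of_norm_lt_one (R := ℝ) m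
      (r := Real.exp (-(t ^ (1 / 4 : ℝ)))) (by
        rw [Real.norm_eq_abs, abs_of_pos (Real.exp_pos _), Real.exp_lt_one_iff]
        linarith)
    refine this.congr fun k => ?_
    rw [decay, ← Real.exp_nat_mul]
    simp
  refine Summable.of_nat_of_neg (h1.congr fun k => by simp) (h1.congr fun k => ?_)
  rw [decay_neg]
  simp

theorem profile_le_decay (p : ℕ) (t : ℝ) (k : ℤ) : profile p t k ≤ decay t k := by
  rcases eq_or_ne k 0 with rfl | hk
  · rw [profile_zero]
    exact (decay_pos _ _).le
  · refine mul_le_of_le_one_right (decay_pos t k).le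
      (Real.rpow_le_one_of_one_le_of_nonpos ?_ ?_)
    · exact_mod_cast Int.one_le_abs hk
    · have := Nat.cast_nonneg (α := ℝ) p
      linarith

/-- Uniform exponential decay, away from the initial time, of coefficients bounded as in
`IsCoeffSolution`. -/
theorem exists_le_decay {ν : ℝ} (hν : 0 < ν) {p : ℕ} {c : ℤ → ℂ} (hc0 : c 0 = 0)
    (hc : Summable fun k : ℤ => |(k : ℝ)| ^ (2 * (p + 1)) * ‖c k‖ ^ 2) :
    ∃ A : ℝ, 0 ≤ A ∧ ∀ (k : ℤ) (t : ℝ), 0 ≤ t →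
      Real.exp (-((ν * k) ^ 4 * t)) * ‖c k‖ + profile p t k ≤ A * decay t k := by
  obtain ⟨K, hK1, hK⟩ := exists_heat_le hν
  have hK0 : 0 ≤ K := zero_le_one.trans hK1
  set B := ∑' k : ℤ, |(k : ℝ)| ^ (2 * (p + 1)) * ‖c k‖ ^ 2
  have hB : ∀ k, ‖c k‖ ≤ √B := by
    intro k
    rcases eq_or_ne k 0 with rfl | hk
    · rw [hc0, norm_zero]
      exact Real.sqrt_nonneg _
    · refine Real.le_sqrt_of_sq_le ?_
      have h1 : (1 : ℝ) ≤ |(k : ℝ)| ^ (2 * (p + 1)) :=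
        one_le_pow₀ (by exact_mod_cast Int.one_le_abs hk)
      exact (le_mul_of_one_le_left (sq_nonneg _) h1).trans
        (hc.le_tsum k fun j _ => by positivity)
  refine ⟨K * √B + 1, by positivity, fun k t ht => ?_⟩
  have hd := decay_pos t k
  have h1 : Real.exp (-((ν * k) ^ 4 * t)) ≤ K * decay t k := by
    refine (hK k t ht).trans (mul_le_mul_of_nonneg_left ?_ hK0)
    refine mul_le_of_le_one_right hd.le ?_
    rw [Real.exp_le_one_iff, neg_nonpos]
    positivity
  have h2 : Real.exp (-((ν * k) ^ 4 * t)) * ‖c k‖ ≤ K * decay t k * √B :=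
    mul_le_mul h1 (hB k) (norm_nonneg _) (by positivity)
  have h3 := profile_le_decay p t k
  linarith

/-! ### Regularity of the solution in space and time -/

theorem integrableOn_exp_neg_mul_Ioi {b : ℝ} (hb : 0 < b) :
    IntegrableOn (fun t => Real.exp (-(b * t))) (Ioi 0) ∧
      ∫ t in Ioi (0 : ℝ), Real.exp (-(b * t)) = 1 / b := by
  have h : ∫ t in Ioi (0 : ℝ), Real.exp (-(b * t)) = 1 / b := by
    have := integral_exp_mul_Ioi (neg_lt_zero.2 hb) 0
    simp only [neg_mul, mul_zero, Real.exp_zero] at this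
    rw [this]
    field_simp
  exact ⟨Integrable.of_integral_ne_zero (by rw [h]; positivity), h⟩

/-- The square of the weight has a time integral of size `|k|^{-4}`. -/
theorem integrableOn_decay_sq {k : ℤ} (hk : k ≠ 0) :
    IntegrableOn (fun t => decay t k ^ 2) (Ioi 0) ∧
      ∫ t in Ioi (0 : ℝ), decay t k ^ 2 = (3 / 2) * |(k : ℝ)| ^ (-4 : ℝ) := by
  have hk0 : 0 < |(k : ℝ)| := abs_pos.2 (Int.cast_ne_zero.2 hk)
  have h : ∫ t in Ioi (0 : ℝ), decay t k ^ 2 = (3 / 2) * |(k : ℝ)| ^ (-4 : ℝ) := by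
    have h1 := integral_exp_neg_mul_rpow (p := 1 / 4) (b := 2 * |(k : ℝ)|) (by norm_num)
      (by positivity)
    have h2 : ∀ t : ℝ, decay t k ^ 2 = Real.exp (-(2 * |(k : ℝ)|) * t ^ (1 / 4 : ℝ)) := by
      intro t
      rw [decay, ← Real.exp_nat_mul]
      congr 1
      push_cast
      ring
    have h3 : Real.Gamma (1 / (1 / 4) + 1) = 24 := by
      have := Real.Gamma_nat_eq_factorial 4
      norm_num [Nat.factorial] at this ⊢
    have h4 : (2 : ℝ) ^ (-4 : ℝ) = 1 / 16 := by
      rw [Real.rpow_neg (by norm_num)]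
      norm_num
    simp only [h2]
    rw [h1, h3, Real.mul_rpow (by norm_num) hk0.le]
    norm_num [h4]
    ring
  have h5 : 0 < |(k : ℝ)| ^ (-4 : ℝ) := Real.rpow_pos_of_pos hk0 _
  -- a function with nonzero Bochner integral is integrable
  exact ⟨Integrable.of_integral_ne_zero (by rw [h]; positivity), h⟩

namespace IsCoeffSolution

variable {ν : ℝ} {p : ℕ} {c : ℤ → ℂ} {T : ℝ} {a : ℤ → ℝ → ℂ}

theorem apply_zero (ha : IsCoeffSolution ν p c T a) (hc0 : c 0 = 0) {t : ℝ}
    (ht : t ∈ Icc 0 T) : a 0 t = 0 := by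
  have := ha.norm_le 0 t ht
  rw [hc0, profile_zero, norm_zero, mul_zero, add_zero] at this
  exact norm_le_zero_iff.1 this

theorem pow_mul_norm_sq_le (ha : IsCoeffSolution ν p c T a) {t : ℝ} (ht : t ∈ Icc 0 T) (k : ℤ) :
    |(k : ℝ)| ^ (2 * (p + 1)) * ‖a k t‖ ^ 2 ≤ majorant 1 p c k ^ 2 := by
  have h1 : |(k : ℝ)| ^ (2 * (p + 1)) * ‖a k t‖ ^ 2 =
      (|(k : ℝ)| ^ (p + 1) * ‖a k t‖) ^ 2 := by ring
  rw [h1]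
  refine pow_le_pow_left₀ (by positivity) ?_ 2
  have h2 : Real.exp (-((ν * k) ^ 4 * t)) * ‖c k‖ ≤ ‖c k‖ := by
    refine mul_le_of_le_one_left (norm_nonneg _) ?_
    rw [Real.exp_le_one_iff, neg_nonpos]
    have := ht.1
    positivity
  have h3 : |(k : ℝ)| ^ (p + 1) * profile p t k ≤ |(k : ℝ)| ^ (-(3 / 4) : ℝ) :=
    (pow_mul_profile_le p t k).trans (mul_le_of_le_one_right
      (Real.rpow_nonneg (abs_nonneg _) _) (decay_le_one ht.1 k))
  calc |(k : ℝ)| ^ (p + 1) * ‖a k t‖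
      ≤ |(k : ℝ)| ^ (p + 1) * (‖c k‖ + profile p t k) := by
        gcongr
        exact (ha.norm_le k t ht).trans (by gcongr)
    _ ≤ _ := by
        rw [majorant, mul_add, one_mul]
        gcongr

theorem exists_norm_le_decay (ha : IsCoeffSolution ν p c T a) (hν : 0 < ν) (hc0 : c 0 = 0)
    (hc : Summable fun k : ℤ => |(k : ℝ)| ^ (2 * (p + 1)) * ‖c k‖ ^ 2) :
    ∃ A : ℝ, 0 ≤ A ∧ ∀ k, ∀ t ∈ Icc 0 T, ‖a k t‖ ≤ A * decay t k := by
  obtain ⟨A, hA0, hA⟩ := exists_le_decay hν hc0 hc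
  exact ⟨A, hA0, fun k t ht => (ha.norm_le k t ht).trans (hA k t ht.1)⟩

theorem summable_pow_mul_norm (ha : IsCoeffSolution ν p c T a) (hν : 0 < ν) (hc0 : c 0 = 0)
    (hc : Summable fun k : ℤ => |(k : ℝ)| ^ (2 * (p + 1)) * ‖c k‖ ^ 2) {t : ℝ}
    (ht : t ∈ Ioc 0 T) (m : ℕ) : Summable fun k : ℤ => |(k : ℝ)| ^ m * ‖a k t‖ := by
  obtain ⟨A, hA0, hA⟩ := ha.exists_norm_le_decay hν hc0 hc
  refine Summable.of_nonneg_of_le (fun k => by positivity) (fun k => ?_)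
    ((summable_pow_mul_decay ht.1 m).mul_left A)
  have := mul_le_mul_of_nonneg_left (hA k t ⟨ht.1.le, ht.2⟩) (pow_nonneg (abs_nonneg (k : ℝ)) m)
  linarith

/-- Parabolic smoothing: a bound, uniform away from the initial time, of the coefficients in every
Sobolev norm. -/
theorem exists_summable_bound (ha : IsCoeffSolution ν p c T a) (hν : 0 < ν) (hc0 : c 0 = 0)
    (hc : Summable fun k : ℤ => |(k : ℝ)| ^ (2 * (p + 1)) * ‖c k‖ ^ 2) {τ : ℝ}
    (hτ : 0 < τ) (m : ℕ) :
    ∃ D : ℤ → ℝ, Summable D ∧ ∀ t ∈ Icc τ T, ∀ k : ℤ,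
      |(k : ℝ)| ^ m * ‖a k t‖ ^ 2 ≤ D k := by
  obtain ⟨A, hA0, hA⟩ := ha.exists_norm_le_decay hν hc0 hc
  refine ⟨fun k => A ^ 2 * (|(k : ℝ)| ^ m * decay τ k),
    (summable_pow_mul_decay hτ m).mul_left _, fun t ht k => ?_⟩
  have h1 : ‖a k t‖ ≤ A * decay τ k := (hA k t ⟨hτ.le.trans ht.1, ht.2⟩).trans
    (mul_le_mul_of_nonneg_left (decay_anti hτ.le ht.1 k) hA0)
  have hd := decay_pos τ k
  have hd1 := decay_le_one hτ.le k
  have h2 : ‖a k t‖ ^ 2 ≤ A ^ 2 * decay τ k := by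
    calc ‖a k t‖ ^ 2 ≤ (A * decay τ k) ^ 2 := by gcongr
      _ = A ^ 2 * decay τ k * decay τ k := by ring
      _ ≤ A ^ 2 * decay τ k := mul_le_of_le_one_right (by positivity) hd1
  have := mul_le_mul_of_nonneg_left h2 (pow_nonneg (abs_nonneg (k : ℝ)) m)
  linarith

/-- The gain of two derivatives, in the sense of square integrability in time, mode by mode. -/
theorem lintegral_pow_mul_norm_sq_le (ha : IsCoeffSolution ν p c T a) (hν : 0 < ν) (k : ℤ) :
    ∫⁻ t in Ioo 0 T, ENNReal.ofReal (|(k : ℝ)| ^ (2 * (p + 3)) * ‖a k t‖ ^ 2) ≤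
      ENNReal.ofReal (1 / ν ^ 4 * (|(k : ℝ)| ^ (2 * (p + 1)) * ‖c k‖ ^ 2) +
        3 * |(k : ℝ)| ^ (-(3 / 2) : ℝ)) := by
  rcases eq_or_ne k 0 with rfl | hk
  · simp
  have hk0 : 0 < |(k : ℝ)| := abs_pos.2 (Int.cast_ne_zero.2 hk)
  have hk4 : (k : ℝ) ^ 4 = |(k : ℝ)| ^ 4 := (Even.pow_abs (by decide) _).symm
  obtain ⟨hi1, hv1⟩ := integrableOn_exp_neg_mul_Ioi (b := 2 * (ν * k) ^ 4) (by
    rw [mul_pow, hk4]; positivity)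
  obtain ⟨hi2, hv2⟩ := integrableOn_decay_sq hk
  set q : ℝ := |(k : ℝ)| ^ (-((p : ℝ) + 7 / 4)) with hq
  set G : ℝ → ℝ := fun t =>
    2 * |(k : ℝ)| ^ (2 * (p + 3)) * ‖c k‖ ^ 2 * Real.exp (-(2 * (ν * k) ^ 4 * t)) +
      2 * |(k : ℝ)| ^ (2 * (p + 3)) * q ^ 2 * decay t k ^ 2 with hG
  have hGi : IntegrableOn G (Ioi 0) := (hi1.const_mul _).add (hi2.const_mul _)
  have hG0 : ∀ t, 0 ≤ G t := fun t => by positivity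
  have hle : ∀ t ∈ Ioo 0 T, |(k : ℝ)| ^ (2 * (p + 3)) * ‖a k t‖ ^ 2 ≤ G t := by
    intro t ht
    have h1 := pow_le_pow_left₀ (norm_nonneg _) (ha.norm_le k t (Ioo_subset_Icc_self ht)) 2
    have h2 : (Real.exp (-((ν * k) ^ 4 * t)) * ‖c k‖ + profile p t k) ^ 2 ≤
        2 * (Real.exp (-((ν * k) ^ 4 * t)) * ‖c k‖) ^ 2 + 2 * profile p t k ^ 2 := by
      nlinarith [sq_nonneg (Real.exp (-((ν * k) ^ 4 * t)) * ‖c k‖ - profile p t k)]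
    have h3 : Real.exp (-((ν * k) ^ 4 * t)) ^ 2 = Real.exp (-(2 * (ν * k) ^ 4 * t)) := by
      rw [← Real.exp_nat_mul]
      congr 1
      push_cast
      ring
    have h4 := mul_le_mul_of_nonneg_left (h1.trans h2)
      (pow_nonneg (abs_nonneg (k : ℝ)) (2 * (p + 3)))
    refine h4.trans (le_of_eq ?_)
    rw [hG, mul_pow, h3, profile, mul_pow]
    ring
  have hint : ∫ t in Ioi (0 : ℝ), G t = 1 / ν ^ 4 * (|(k : ℝ)| ^ (2 * (p + 1)) * ‖c k‖ ^ 2) +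
      3 * |(k : ℝ)| ^ (-(3 / 2) : ℝ) := by
    rw [hG, integral_add (hi1.const_mul _) (hi2.const_mul _), integral_const_mul,
      integral_const_mul, hv1, hv2]
    congr 1
    · rw [mul_pow, hk4]
      field_simp
      ring
    · have h5 : |(k : ℝ)| ^ (2 * (p + 3)) * q ^ 2 * |(k : ℝ)| ^ (-4 : ℝ) =
          |(k : ℝ)| ^ (-(3 / 2) : ℝ) := by
        rw [hq, ← Real.rpow_natCast, ← Real.rpow_natCast (|(k : ℝ)| ^ _), ← Real.rpow_mul hk0.le,
          ← Real.rpow_add hk0, ← Real.rpow_add hk0]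
        congr 1
        push_cast
        ring
      rw [← h5]
      ring
  calc ∫⁻ t in Ioo 0 T, ENNReal.ofReal (|(k : ℝ)| ^ (2 * (p + 3)) * ‖a k t‖ ^ 2)
      ≤ ∫⁻ t in Ioo 0 T, ENNReal.ofReal (G t) :=
        setLIntegral_mono' measurableSet_Ioo fun t ht => ENNReal.ofReal_le_ofReal (hle t ht)
    _ ≤ ∫⁻ t in Ioi 0, ENNReal.ofReal (G t) := lintegral_mono_set Ioo_subset_Ioi_self
    _ = ENNReal.ofReal (∫ t in Ioi 0, G t) :=
        (ofReal_integral_eq_lintegral_ofReal hGi (Filter.Eventually.of_forall hG0)).symm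
    _ = _ := by rw [hint]

variable {L : ℝ} [Fact (0 < L)]

theorem continuousOn_hdot (ha : IsCoeffSolution ν p c T a)
    (hc : Summable fun k : ℤ => |(k : ℝ)| ^ (2 * (p + 1)) * ‖c k‖ ^ 2)
    {s : ℝ} (hs : s = (p + 1 : ℕ)) {u : ℝ → HDot L s}
    (hu : ∀ t ∈ Ico 0 T, ∀ k, coeff (HDot.toL2 (u t)) k = a k t) : ContinuousOn u (Ico 0 T) := by
  refine HDot.continuousOn_of_coeff (summable_majorant_sq 1 hc) (fun t ht k => ?_) fun k => ?_
  · rw [abs_rpow_two_mul hs, hu t ht]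
    exact ha.pow_mul_norm_sq_le (Ico_subset_Icc_self ht) k
  · exact (ha.continuous k).continuousOn.congr fun t ht => hu t ht k

theorem memLp_hdot (ha : IsCoeffSolution ν p c T a) (hν : 0 < ν) (hc0 : c 0 = 0)
    (hc : Summable fun k : ℤ => |(k : ℝ)| ^ (2 * (p + 1)) * ‖c k‖ ^ 2)
    {s : ℝ} (hs : s = (p + 3 : ℕ)) {u : ℝ → HDot L s}
    (hu : ∀ t ∈ Ioo 0 T, ∀ k, coeff (HDot.toL2 (u t)) k = a k t) :
    MemLp u 2 (volume.restrict (Ioo 0 T)) := by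
  have hcont : ContinuousOn u (Ioo 0 T) := by
    intro t ht
    obtain ⟨D, hD, hbound⟩ := ha.exists_summable_bound hν hc0 hc (half_pos ht.1) (2 * (p + 3))
    have h1 : ContinuousOn u (Ioo (t / 2) T) := by
      have hsub : Ioo (t / 2) T ⊆ Ioo 0 T := Ioo_subset_Ioo_left (half_pos ht.1).le
      refine HDot.continuousOn_of_coeff hD (fun r hr k => ?_) fun k => ?_
      · rw [abs_rpow_two_mul hs, hu r (hsub hr)]
        exact hbound r (Ioo_subset_Icc_self hr) k
      · exact (ha.continuous k).continuousOn.congr fun r hr => hu r (hsub hr) k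
    exact (h1.continuousAt (Ioo_mem_nhds (half_lt_self ht.1) ht.2)).continuousWithinAt
  have hmeas := hcont.aestronglyMeasurable (μ := volume) measurableSet_Ioo
  rw [memLp_two_iff_integrable_sq_norm hmeas]
  refine ⟨hmeas.norm.pow 2, ?_⟩
  rw [hasFiniteIntegral_iff_ofReal (Filter.Eventually.of_forall fun t => sq_nonneg _)]
  have h1 : Summable fun k : ℤ => |(k : ℝ)| ^ (-(3 / 2) : ℝ) :=
    Real.summable_abs_int_rpow (by norm_num)
  have hE := (hc.mul_left (1 / ν ^ 4)).add (h1.mul_left 3)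
  have hE0 : ∀ k : ℤ, 0 ≤ 1 / ν ^ 4 * (|(k : ℝ)| ^ (2 * (p + 1)) * ‖c k‖ ^ 2) +
      3 * |(k : ℝ)| ^ (-(3 / 2) : ℝ) := fun k => by
    have := Real.rpow_nonneg (abs_nonneg (k : ℝ)) (-(3 / 2))
    positivity
  calc ∫⁻ t in Ioo 0 T, ENNReal.ofReal (‖u t‖ ^ 2)
      = ∫⁻ t in Ioo 0 T, ∑' k : ℤ,
          ENNReal.ofReal (|(k : ℝ)| ^ (2 * (p + 3)) * ‖a k t‖ ^ 2) := by
        refine setLIntegral_congr_fun measurableSet_Ioo fun t ht => ?_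
        have hsum : Summable fun k : ℤ => |(k : ℝ)| ^ (2 * (p + 3)) * ‖a k t‖ ^ 2 := by
          obtain ⟨D, hD, hbound⟩ := ha.exists_summable_bound hν hc0 hc ht.1 (2 * (p + 3))
          exact Summable.of_nonneg_of_le (fun k => by positivity)
            (hbound t ⟨le_rfl, ht.2.le⟩) hD
        rw [← ENNReal.ofReal_tsum_of_nonneg (fun k => by positivity) hsum, HDot.norm_sq_eq]
        congr 1
        refine tsum_congr fun k => ?_
        rw [abs_rpow_two_mul hs, hu t ht]
    _ = ∑' k : ℤ, ∫⁻ t in Ioo 0 T,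
          ENNReal.ofReal (|(k : ℝ)| ^ (2 * (p + 3)) * ‖a k t‖ ^ 2) := by
        refine lintegral_tsum fun k => ?_
        have := ha.continuous k
        exact (ENNReal.continuous_ofReal.comp (by fun_prop)).measurable.aemeasurable
    _ ≤ ∑' k : ℤ, ENNReal.ofReal (1 / ν ^ 4 * (|(k : ℝ)| ^ (2 * (p + 1)) * ‖c k‖ ^ 2) +
        3 * |(k : ℝ)| ^ (-(3 / 2) : ℝ)) :=
        ENNReal.tsum_le_tsum fun k => ha.lintegral_pow_mul_norm_sq_le hν k
    _ < ⊤ := by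
        rw [← ENNReal.ofReal_tsum_of_nonneg hE0 hE]
        exact ENNReal.ofReal_lt_top

end IsCoeffSolution

/-! ### Testing Fourier series against smooth functions -/

theorem continuous_fourier_coe {L : ℝ} (k : ℤ) : Continuous fun x : ℝ => fourier k (x : AddCircle L) :=
  (fourier k).continuous.comp (AddCircle.continuous_mk' L)

theorem norm_fourier_coe {L : ℝ} (k : ℤ) (x : ℝ) : ‖fourier k (x : AddCircle L)‖ = 1 :=
  Circle.norm_coe _

section Modes

variable {L : ℝ}

theorem ae_restrict_of_ae_haarAddCircle [Fact (0 < L)] {P : AddCircle L → Prop}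
    (h : ∀ᵐ x ∂(AddCircle.haarAddCircle : Measure (AddCircle L)), P x) :
    ∀ᵐ x : ℝ ∂(volume.restrict (Ioc 0 L)), P (x : AddCircle L) := by
  have h1 : ∀ᵐ x ∂(volume : Measure (AddCircle L)), P x := by
    rw [AddCircle.volume_eq_smul_haarAddCircle]
    exact Measure.ae_smul_measure h _
  have h2 := AddCircle.measurePreserving_mk L 0
  rw [zero_add] at h2
  exact h2.quasiMeasurePreserving.ae h1

/-- Termwise integration over one period of a series with summable majorant. -/
theorem hasSum_integral_fourier [Fact (0 < L)] {f : ℝ → ℝ} {d : ℤ → ℝ → ℂ} {B : ℤ → ℝ}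
    (hd : ∀ k, Continuous (d k)) (hdB : ∀ k, ∀ x ∈ Icc 0 L, ‖d k x‖ ≤ B k) (hB : Summable B)
    (hf : ∀ᵐ x : ℝ ∂(volume.restrict (Ioc 0 L)),
      HasSum (fun k => fourier k (x : AddCircle L) * d k x) ((f x : ℝ) : ℂ)) :
    HasSum (fun k => ∫ x in (0 : ℝ)..L, fourier k (x : AddCircle L) * d k x)
      ((∫ x in (0 : ℝ)..L, f x : ℝ) : ℂ) := by
  have hL : 0 < L := Fact.out
  rw [← intervalIntegral.integral_ofReal]
  rw [ae_restrict_iff' measurableSet_Ioc] at hf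
  refine intervalIntegral.hasSum_integral_of_dominated_convergence (fun k _ => B k)
    (fun k => ((continuous_fourier_coe k).mul (hd k)).aestronglyMeasurable)
    (fun k => Filter.Eventually.of_forall fun x hx => ?_)
    (Filter.Eventually.of_forall fun x _ => hB) intervalIntegrable_const ?_
  · rw [uIoc_of_le hL.le] at hx
    rw [norm_mul, norm_fourier_coe, one_mul]
    exact hdB k x (Ioc_subset_Icc_self hx)
  · rwa [uIoc_of_le hL.le]

/-- The pairing `∫₀ᴸ exp (2πikx/L) ψ(x) dx` of a function with a Fourier mode. -/
def mode (L : ℝ) (ψ : ℝ → ℝ) (k : ℤ) : ℂ :=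
  ∫ x in (0 : ℝ)..L, fourier k (x : AddCircle L) * (ψ x : ℂ)

theorem mode_deriv {ψ : ℝ → ℝ} (hψ : ContDiff ℝ 1 ψ) (hper : Function.Periodic ψ L) (k : ℤ) :
    mode L (deriv ψ) k = -(Complex.I * ((2 * Real.pi / L : ℝ) : ℂ) * k) * mode L ψ k := by
  have h1 : ∀ x ∈ uIcc 0 L, HasDerivAt (fun y : ℝ => fourier k (y : AddCircle L))
      (2 * Real.pi * Complex.I * k / L * fourier k (x : AddCircle L)) x :=
    fun x _ => hasDerivAt_fourier L k x
  have h2 : ∀ x ∈ uIcc 0 L, HasDerivAt (fun y : ℝ => (ψ y : ℂ)) ((deriv ψ x : ℝ) : ℂ) x :=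
    fun x _ => ((hψ.differentiable (by norm_num) x).hasDerivAt).ofReal_comp
  have hc1 : Continuous fun x : ℝ =>
      2 * Real.pi * Complex.I * k / L * fourier k (x : AddCircle L) :=
    continuous_const.mul (continuous_fourier_coe k)
  have hc2 : Continuous fun x : ℝ => ((deriv ψ x : ℝ) : ℂ) :=
    Complex.continuous_ofReal.comp (hψ.continuous_deriv (by norm_num))
  have h3 := intervalIntegral.integral_mul_deriv_eq_deriv_mul h1 h2
    (hc1.intervalIntegrable _ _) (hc2.intervalIntegrable _ _)
  unfold mode
  rw [h3]
  have h4 : ψ L = ψ 0 := by simpa using hper 0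
  have h5 : ((L : ℝ) : AddCircle L) = ((0 : ℝ) : AddCircle L) := by
    rw [AddCircle.coe_period, AddCircle.coe_zero]
  rw [h4, h5, sub_self, zero_sub, ← intervalIntegral.integral_const_mul,
    ← intervalIntegral.integral_neg]
  refine intervalIntegral.integral_congr fun x _ => ?_
  push_cast
  ring

theorem mode_iteratedDeriv {ψ : ℝ → ℝ} (hψ : ContDiff ℝ ∞ ψ) (hper : Function.Periodic ψ L)
    (m : ℕ) (k : ℤ) : mode L (iteratedDeriv m ψ) k =
      (-(Complex.I * ((2 * Real.pi / L : ℝ) : ℂ) * k)) ^ m * mode L ψ k := by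
  have hsm : ∀ m, ContDiff ℝ 1 (iteratedDeriv m ψ) := fun m => by
    rw [iteratedDeriv_eq_iterate]
    exact (hψ.iterate_deriv m).of_le (by exact_mod_cast le_top)
  have hp : ∀ m, Function.Periodic (iteratedDeriv m ψ) L := by
    intro m
    induction m with
    | zero => simpa using hper
    | succ m ih =>
      intro x
      rw [iteratedDeriv_succ, ← deriv_comp_add_const]
      congr 1
      exact funext ih
  induction m with
  | zero => simp
  | succ m ih =>
    rw [iteratedDeriv_succ, mode_deriv (hsm m) (hp m), ih]
    ring

/-- The Fourier series of the weak derivative. -/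
theorem isWeakDeriv_of_coeff [Fact (0 < L)] {u v : L2 L} (hu : Summable fun k => ‖coeff u k‖)
    (hv : Summable fun k => ‖coeff v k‖)
    (huv : ∀ k, coeff v k = Complex.I * ((2 * Real.pi / L : ℝ) : ℂ) * k * coeff u k) :
    IsWeakDeriv u v := by
  intro φ hφ hper
  have key : ∀ (w : L2 L), (Summable fun k => ‖coeff w k‖) → ∀ ψ : ℝ → ℝ, Continuous ψ →
      HasSum (fun k => coeff w k * mode L ψ k)
        ((∫ x in (0 : ℝ)..L, w (x : AddCircle L) * ψ x : ℝ) : ℂ) := by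
    intro w hw ψ hψ
    obtain ⟨C, hC⟩ := isCompact_Icc.exists_bound_of_continuousOn (s := Icc 0 L) hψ.continuousOn
    have h1 := hasSum_integral_fourier (L := L) (f := fun x => w (x : AddCircle L) * ψ x)
      (d := fun k x => coeff w k * (ψ x : ℂ)) (B := fun k => ‖coeff w k‖ * C)
      (fun k => by fun_prop) (fun k x hx => by
        rw [norm_mul, Complex.norm_real]
        exact mul_le_mul_of_nonneg_left (hC x hx) (norm_nonneg _)) (hw.mul_right C) (by
        filter_upwards [ae_restrict_of_ae_haarAddCircle (ae_hasSum_of_summable_coeff hw)] with x hx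
        have := hx.mul_right (ψ x : ℂ)
        push_cast
        refine this.congr_fun fun k => ?_
        ring)
    refine h1.congr_fun fun k => ?_
    rw [mode, ← intervalIntegral.integral_const_mul]
    refine intervalIntegral.integral_congr fun x _ => ?_
    ring
  have h1 := key u hu (deriv φ) (hφ.continuous_deriv (by exact_mod_cast le_top))
  have h2 := (key v hv φ hφ.continuous).neg
  have h3 : (fun k => coeff u k * mode L (deriv φ) k) = fun k => -(coeff v k * mode L φ k) := by
    funext k
    rw [mode_deriv (hφ.of_le (by exact_mod_cast le_top)) hper, huv]
    ring
  rw [h3] at h1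
  have h4 := h1.unique h2
  exact_mod_cast h4

/-- The square of an absolutely convergent Fourier series of a derivative. -/
theorem hasSum_sq_of_hasSum {ν : ℝ} {a : ℤ → ℂ} (ha : Summable fun k : ℤ => ‖(k : ℂ) * a k‖)
    {x : AddCircle L} {z : ℂ}
    (hz : HasSum (fun k => Complex.I * (ν : ℂ) * k * a k * fourier k x) z) :
    HasSum (fun k => (-(ν : ℂ) ^ 2 * derivConv a a k) * fourier k x) (z ^ 2) := by
  set f : ℤ → ℂ := fun k => Complex.I * (ν : ℂ) * k * a k * fourier k x with hf
  have hfn : Summable fun k => ‖f k‖ := by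
    refine (ha.mul_left ‖Complex.I * (ν : ℂ)‖).congr fun k => ?_
    have h1 : ‖fourier k x‖ = 1 := Circle.norm_coe _
    rw [hf]
    simp only [norm_mul, h1, mul_one, mul_assoc]
  have h1 : HasSum (fun q : ℤ × ℤ => f q.1 * f q.2) (z * z) :=
    hz.mul hz (summable_mul_of_summable_norm hfn hfn)
  -- the change of indices `(k, j) ↦ (j, k - j)`
  let e : ℤ × ℤ ≃ ℤ × ℤ :=
    { toFun := fun q => (q.2, q.1 - q.2)
      invFun := fun q => (q.1 + q.2, q.1)
      left_inv := fun q => by ext <;> simp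
      right_inv := fun q => by ext <;> simp }
  have h2 := e.hasSum_iff.2 h1
  have h3 : Summable fun q : ℤ × ℤ => (q.2 * a q.2) * (((q.1 - q.2 : ℤ) : ℂ) * a (q.1 - q.2)) :=
    e.summable_iff.2 (summable_mul_of_summable_norm ha ha)
  rw [pow_two z]
  refine h2.prod_fiberwise fun k => ?_
  have h4 := (h3.prod_factor k).hasSum.mul_left (-(ν : ℂ) ^ 2 * fourier k x)
  have h5 : -(ν : ℂ) ^ 2 * fourier k x *
      ∑' j : ℤ, (j * a j) * (((k - j : ℤ) : ℂ) * a (k - j)) =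
      -(ν : ℂ) ^ 2 * derivConv a a k * fourier k x := by
    rw [derivConv]
    ring
  rw [← h5]
  refine h4.congr_fun fun j => ?_
  have h6 : fourier k x = fourier j x * fourier (k - j) x := by
    rw [← fourier_add, add_sub_cancel]
  simp only [e, hf, Function.comp_apply, Equiv.coe_fn_mk]
  rw [h6]
  linear_combination (ν : ℂ) ^ 2 * j * a j * fourier j x * ((k - j : ℤ) : ℂ) * a (k - j) *
    fourier (k - j) x * Complex.I_sq

end Modes

/-! ### Test functions -/

theorem norm_mode_le {L : ℝ} (hL : 0 ≤ L) {ψ : ℝ → ℝ} {M : ℝ} (hM : ∀ x ∈ Icc 0 L, ‖ψ x‖ ≤ M)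
    (k : ℤ) : ‖mode L ψ k‖ ≤ M * L := by
  have h := intervalIntegral.norm_integral_le_of_norm_le_const (a := 0) (b := L) (C := M)
    (f := fun x : ℝ => fourier k (x : AddCircle L) * (ψ x : ℂ)) fun x hx => by
      rw [uIoc_of_le hL] at hx
      rw [norm_mul, norm_fourier_coe, one_mul, Complex.norm_real]
      exact hM x (Ioc_subset_Icc_self hx)
  rwa [sub_zero, abs_of_nonneg hL] at h

namespace IsTestFunction

variable {L T : ℝ} {φ : ℝ → ℝ → ℝ}

theorem continuous_uncurry (h : IsTestFunction L T φ) :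
    Continuous fun q : ℝ × ℝ => φ q.1 q.2 := h.smooth.continuous

theorem contDiff_space (h : IsTestFunction L T φ) (t : ℝ) : ContDiff ℝ ∞ (φ t) :=
  h.smooth.comp (contDiff_const.prodMk contDiff_id)

theorem hasDerivAt_time (h : IsTestFunction L T φ) (t x : ℝ) :
    HasDerivAt (fun τ => φ τ x) (deriv (fun τ => φ τ x) t) t := by
  have h1 : ContDiff ℝ ∞ fun τ => φ τ x := h.smooth.comp (contDiff_id.prodMk contDiff_const)
  exact (h1.differentiable (by simp) t).hasDerivAt

theorem continuous_deriv_time (h : IsTestFunction L T φ) :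
    Continuous fun q : ℝ × ℝ => deriv (fun τ => φ τ q.2) q.1 := by
  have h1 : ∀ q : ℝ × ℝ, deriv (fun τ => φ τ q.2) q.1 =
      fderiv ℝ (fun r : ℝ × ℝ => φ r.1 r.2) q (1, 0) := by
    intro q
    have h2 := (h.smooth.differentiable (by simp) q).hasFDerivAt
    have h3 : HasDerivAt (fun τ : ℝ => (τ, q.2)) (1, 0) q.1 :=
      (hasDerivAt_id q.1).prodMk (hasDerivAt_const q.1 q.2)
    exact (h2.comp_hasDerivAt q.1 h3).deriv
  simp only [h1]
  exact (h.smooth.continuous_fderiv (by simp)).clm_apply continuous_const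

theorem continuous_mode {g : ℝ → ℝ → ℝ} (hg : Continuous fun q : ℝ × ℝ => g q.1 q.2) (k : ℤ) :
    Continuous fun t => mode L (g t) k := by
  have h1 : Continuous fun q : ℝ × ℝ => fourier k (q.2 : AddCircle L) * (g q.1 q.2 : ℂ) :=
    ((continuous_fourier_coe k).comp continuous_snd).mul (Complex.continuous_ofReal.comp hg)
  exact intervalIntegral.continuous_parametric_intervalIntegral_of_continuous
    (f := fun t x => fourier k (x : AddCircle L) * (g t x : ℂ)) h1 continuous_const

theorem hasDerivAt_mode (h : IsTestFunction L T φ) (hL : 0 ≤ L) (k : ℤ) (t : ℝ) :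
    HasDerivAt (fun τ => mode L (φ τ) k) (mode L (fun x => deriv (fun τ => φ τ x) t) k) t := by
  obtain ⟨M, hM⟩ := (isCompact_Icc.prod isCompact_Icc).exists_bound_of_continuousOn
    (s := Icc (t - 1) (t + 1) ×ˢ Icc 0 L) h.continuous_deriv_time.continuousOn
  have hslice : ∀ τ, Continuous fun x => φ τ x := fun τ => (h.contDiff_space τ).continuous
  have hslice' : Continuous fun x => deriv (fun τ => φ τ x) t :=
    h.continuous_deriv_time.comp (continuous_const.prodMk continuous_id)
  have hcont : ∀ τ, Continuous fun x : ℝ => fourier k (x : AddCircle L) * (φ τ x : ℂ) := fun τ =>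
    (continuous_fourier_coe k).mul (Complex.continuous_ofReal.comp (hslice τ))
  refine (intervalIntegral.hasDerivAt_integral_of_dominated_loc_of_deriv_le
    (F := fun τ x => fourier k (x : AddCircle L) * (φ τ x : ℂ))
    (F' := fun τ x => fourier k (x : AddCircle L) * ((deriv (fun τ => φ τ x) τ : ℝ) : ℂ))
    (bound := fun _ => M) (Icc_mem_nhds (sub_one_lt t) (lt_add_one t))
    (Filter.Eventually.of_forall fun τ => (hcont τ).aestronglyMeasurable)
    ((hcont t).intervalIntegrable _ _)
    ((continuous_fourier_coe k).mul
      (Complex.continuous_ofReal.comp hslice')).aestronglyMeasurable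
    (Filter.Eventually.of_forall fun x hx τ hτ => ?_) intervalIntegrable_const
    (Filter.Eventually.of_forall fun x _ τ _ => ?_)).2
  · rw [uIoc_of_le hL] at hx
    rw [norm_mul, norm_fourier_coe, one_mul, Complex.norm_real]
    exact hM (τ, x) ⟨hτ, Ioc_subset_Icc_self hx⟩
  · exact (h.hasDerivAt_time τ x).ofReal_comp.const_mul _

end IsTestFunction

/-! ### The equation in the sense of distributions -/

namespace IsCoeffSolution

variable {ν : ℝ} {p : ℕ} {c : ℤ → ℂ} {T : ℝ} {a : ℤ → ℝ → ℂ}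

/-- Away from the initial time, the coefficients and the nonlinear term decay faster than any
power of the frequency, uniformly in time. -/
theorem exists_rapid_decay (ha : IsCoeffSolution ν p c T a) (hν : 0 < ν) (hc0 : c 0 = 0)
    (hc : Summable fun k : ℤ => |(k : ℝ)| ^ (2 * (p + 1)) * ‖c k‖ ^ 2) {τ : ℝ} (hτ : 0 < τ) :
    ∃ B : ℤ → ℝ, (∀ k, 0 ≤ B k) ∧ (∀ m : ℕ, Summable fun k : ℤ => |(k : ℝ)| ^ m * B k) ∧
      ∀ t ∈ Icc τ T, ∀ k, ‖a k t‖ ≤ B k ∧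
        ‖derivConv (fun j => a j t) (fun j => a j t) k‖ ≤ B k := by
  obtain ⟨A, hA0, hA⟩ := ha.exists_norm_le_decay hν hc0 hc
  have hτ16 : 0 < τ / 16 := by positivity
  set W : ℤ → ℝ := fun k => A * (|(k : ℝ)| * decay (τ / 16) k) with hW
  have hW0 : ∀ k, 0 ≤ W k := fun k => by
    have := decay_pos (τ / 16) k
    positivity
  have hW2 : Summable fun k => W k ^ 2 := by
    refine Summable.of_nonneg_of_le (fun k => sq_nonneg _) (fun k => ?_)
      ((summable_pow_mul_decay hτ16 2).mul_left (A ^ 2))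
    have hd := decay_pos (τ / 16) k
    have hd1 := decay_le_one hτ16.le k
    calc W k ^ 2 = A ^ 2 * (|(k : ℝ)| ^ 2 * (decay (τ / 16) k * decay (τ / 16) k)) := by
          rw [hW]; ring
      _ ≤ A ^ 2 * (|(k : ℝ)| ^ 2 * (decay (τ / 16) k * 1)) := by gcongr
      _ = _ := by ring
  set S := ∑' j, W j ^ 2
  have hS0 : 0 ≤ S := tsum_nonneg fun j => sq_nonneg _
  refine ⟨fun k => (A + S) * decay (τ / 16) k, fun k => ?_, fun m => ?_, fun t ht k => ?_⟩
  · have := decay_pos (τ / 16) k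
    positivity
  · refine ((summable_pow_mul_decay hτ16 m).mul_left (A + S)).congr fun k => ?_
    ring
  · have hat : ∀ k, ‖a k t‖ ≤ A * (decay (τ / 16) k * decay (τ / 16) k) := fun k => by
      rw [← pow_two, ← decay_eq_sq hτ.le]
      exact (hA k t ⟨hτ.le.trans ht.1, ht.2⟩).trans
        (mul_le_mul_of_nonneg_left (decay_anti hτ.le ht.1 k) hA0)
    have hd := decay_pos (τ / 16) k
    have hd1 := decay_le_one hτ16.le k
    constructor
    · refine (hat k).trans ?_
      have h1 : decay (τ / 16) k * decay (τ / 16) k ≤ decay (τ / 16) k :=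
        mul_le_of_le_one_right hd.le hd1
      exact mul_le_mul (by linarith) h1 (by positivity) (by positivity)
    · have hb : ∀ k : ℤ, |(k : ℝ)| ^ (0 + 1) * ‖a k t‖ ≤ 1 * W k * decay (τ / 16) k := fun k => by
        calc |(k : ℝ)| ^ (0 + 1) * ‖a k t‖
            ≤ |(k : ℝ)| ^ (0 + 1) * (A * (decay (τ / 16) k * decay (τ / 16) k)) := by
              gcongr
              exact hat k
          _ = _ := by rw [hW]; ring
      have h2 := pow_mul_norm_derivConv_le hτ16.le zero_le_one zero_le_one hW0 hW2 hb hb k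
      simp only [pow_zero, one_mul, mul_one] at h2
      refine h2.trans (mul_le_mul_of_nonneg_right ?_ hd.le)
      linarith

/-- The contribution of the `k`-th Fourier mode to the weak formulation at time `t`. It is the time
derivative of `a k t * mode L (φ t) k`. -/
def modeTerm (ν L : ℝ) (a : ℤ → ℝ → ℂ) (φ : ℝ → ℝ → ℝ) (k : ℤ) (t : ℝ) : ℂ :=
  (-((ν * k) ^ 4) • a k t + quadratic ν (fun j => a j t) k) * mode L (φ t) k +
    a k t * mode L (fun x => deriv (fun τ => φ τ x) t) k

variable {L : ℝ} {φ : ℝ → ℝ → ℝ}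

theorem continuous_modeTerm (ha : IsCoeffSolution ν p c T a) (hφ : IsTestFunction L T φ) (k : ℤ) :
    Continuous (modeTerm ν L a φ k) := by
  have h1 := ha.continuous k
  have h2 := ha.continuous_quadratic k
  have h3 : Continuous fun t => mode L (φ t) k :=
    IsTestFunction.continuous_mode hφ.continuous_uncurry k
  have h4 : Continuous fun t => mode L (fun x => deriv (fun τ => φ τ x) t) k :=
    IsTestFunction.continuous_mode (g := fun t x => deriv (fun τ => φ τ x) t)
      hφ.continuous_deriv_time k
  unfold modeTerm
  fun_prop

theorem integral_modeTerm (ha : IsCoeffSolution ν p c T a) (hL : 0 ≤ L) (hT : 0 ≤ T)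
    (hφ : IsTestFunction L T φ) (k : ℤ) : ∫ t in (0 : ℝ)..T, modeTerm ν L a φ k t = 0 := by
  have hm := fun t => hφ.hasDerivAt_mode hL k t
  have hcm : Continuous fun t => mode L (φ t) k :=
    continuous_iff_continuousAt.2 fun t => (hm t).continuousAt
  have hftc := intervalIntegral.integral_eq_sub_of_hasDerivAt_of_le hT
    (f' := modeTerm ν L a φ k) (f := fun t => a k t * mode L (φ t) k) ((ha.continuous k).mul hcm).continuousOn
    (fun t ht => (ha.hasDerivAt k t ht).mul (hm t))
    ((ha.continuous_modeTerm hφ k).intervalIntegrable _ _)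
  obtain ⟨b, d, hb, hd, hsupp⟩ := hφ.support
  have h0 : mode L (φ 0) k = 0 := by
    have : φ 0 = 0 := funext (hsupp 0 fun h => absurd h.1 (not_le.2 hb))
    simp [mode, this]
  have h1 : mode L (φ T) k = 0 := by
    have : φ T = 0 := funext (hsupp T fun h => absurd h.2 (not_le.2 hd))
    simp [mode, this]
  rw [hftc, h0, h1, mul_zero, mul_zero, sub_self]

theorem exists_norm_modeTerm_le (ha : IsCoeffSolution ν p c T a) (hν : 0 < ν) (hc0 : c 0 = 0)
    (hc : Summable fun k : ℤ => |(k : ℝ)| ^ (2 * (p + 1)) * ‖c k‖ ^ 2)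
    (hL : 0 ≤ L) (hφ : IsTestFunction L T φ) :
    ∃ D : ℤ → ℝ, Summable D ∧ ∀ k, ∀ t ∈ Icc 0 T, ‖modeTerm ν L a φ k t‖ ≤ D k := by
  obtain ⟨b, d, hb, hd, hsupp⟩ := hφ.support
  obtain ⟨B, hB0, hB, hle⟩ := ha.exists_rapid_decay hν hc0 hc hb
  obtain ⟨M, hM⟩ := (isCompact_Icc.prod isCompact_Icc).exists_bound_of_continuousOn
    (s := Icc 0 T ×ˢ Icc 0 L) hφ.continuous_uncurry.continuousOn
  obtain ⟨N, hN⟩ := (isCompact_Icc.prod isCompact_Icc).exists_bound_of_continuousOn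
    (s := Icc 0 T ×ˢ Icc 0 L) hφ.continuous_deriv_time.continuousOn
  have hsum : Summable fun k : ℤ =>
      (ν ^ 4 * |(k : ℝ)| ^ 4 * B k + ν ^ 4 * |(k : ℝ)| ^ 2 * B k) * (|M| * L) +
        B k * (|N| * L) := by
    have h4 := (hB 4).mul_left (ν ^ 4)
    have h2 := (hB 2).mul_left (ν ^ 4)
    have h0 := hB 0
    simp only [pow_zero, one_mul] at h0
    refine (((h4.add h2).mul_right (|M| * L)).add (h0.mul_right (|N| * L))).congr fun k => ?_
    ring
  refine ⟨_, hsum, fun k t ht => ?_⟩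
  by_cases htb : t ∈ Icc b d
  · obtain ⟨h1, h2⟩ := hle t ⟨htb.1, ht.2⟩ k
    have h3 := norm_mode_le hL (ψ := φ t) (M := |M|)
      (fun x hx => (hM (t, x) ⟨ht, hx⟩).trans (le_abs_self M)) k
    have h4 := norm_mode_le hL (ψ := fun x => deriv (fun τ => φ τ x) t) (M := |N|)
      (fun x hx => (hN (t, x) ⟨ht, hx⟩).trans (le_abs_self N)) k
    have hBk := hB0 k
    have h5 : ‖-((ν * k) ^ 4) • a k t + quadratic ν (fun j => a j t) k‖ ≤
        ν ^ 4 * |(k : ℝ)| ^ 4 * B k + ν ^ 4 * |(k : ℝ)| ^ 2 * B k := by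
      refine (norm_add_le _ _).trans (add_le_add ?_ ?_)
      · rw [norm_smul, norm_neg, norm_pow, norm_mul, mul_pow, Real.norm_eq_abs, Real.norm_eq_abs,
          abs_of_pos hν]
        gcongr
      · rw [quadratic, norm_smul, norm_neg, norm_mul, norm_pow, norm_pow, Real.norm_eq_abs,
          Real.norm_eq_abs, abs_of_pos hν]
        gcongr
    calc ‖modeTerm ν L a φ k t‖
        ≤ ‖-((ν * k) ^ 4) • a k t + quadratic ν (fun j => a j t) k‖ * ‖mode L (φ t) k‖ +
          ‖a k t‖ * ‖mode L (fun x => deriv (fun τ => φ τ x) t) k‖ := by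
          rw [← norm_mul, ← norm_mul]
          exact norm_add_le _ _
      _ ≤ _ := by gcongr
  -- outside `[b, d]` the test function vanishes in a neighbourhood of `t`
  · have h0 : φ t = 0 := funext (hsupp t htb)
    have h1 : (fun x => deriv (fun τ => φ τ x) t) = 0 := by
      funext x
      have : (fun τ => φ τ x) =ᶠ[nhds t] fun _ => 0 := by
        filter_upwards [isClosed_Icc.isOpen_compl.mem_nhds htb] with τ hτ
        exact hsupp τ hτ x
      rw [this.deriv_eq]
      simp
    have h2 : modeTerm ν L a φ k t = 0 := by
      rw [modeTerm, h0, h1]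
      simp [mode]
    rw [h2, norm_zero]
    have := hB0 k
    positivity

/-- The weak formulation at time `t` is the sum of the contributions of the Fourier modes. -/
theorem hasSum_modeTerm [Fact (0 < L)] (ha : IsCoeffSolution (2 * Real.pi / L) p c T a)
    (hc0 : c 0 = 0)
    (hc : Summable fun k : ℤ => |(k : ℝ)| ^ (2 * (p + 1)) * ‖c k‖ ^ 2)
    (hφ : IsTestFunction L T φ) {t : ℝ} (ht : t ∈ Ioo 0 T) {u v : L2 L}
    (hu : ∀ k, coeff u k = a k t)
    (hv : ∀ k, coeff v k = Complex.I * ((2 * Real.pi / L : ℝ) : ℂ) * k * a k t) :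
    HasSum (fun k => modeTerm (2 * Real.pi / L) L a φ k t) ((testedEquation φ t u v : ℝ) : ℂ) := by
  have hL : 0 < L := Fact.out
  set ν : ℝ := 2 * Real.pi / L with hνdef
  have hν : 0 < ν := by positivity
  obtain ⟨B, hB0, hB, hle⟩ := ha.exists_rapid_decay hν hc0 hc ht.1
  have hle' := hle t ⟨le_rfl, ht.2.le⟩
  have hBs : Summable B := by simpa using hB 0
  have hka : Summable fun k : ℤ => ‖(k : ℂ) * a k t‖ := by
    refine Summable.of_nonneg_of_le (fun k => norm_nonneg _) (fun k => ?_) (hB 1)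
    rw [norm_mul, Complex.norm_intCast, pow_one]
    exact mul_le_mul_of_nonneg_left (hle' k).1 (abs_nonneg _)
  have hus : Summable fun k => ‖coeff u k‖ :=
    Summable.of_nonneg_of_le (fun k => norm_nonneg _) (fun k => by rw [hu]; exact (hle' k).1) hBs
  have hvs : Summable fun k => ‖coeff v k‖ := by
    refine (hka.mul_left ‖Complex.I * (ν : ℂ)‖).congr fun k => ?_
    rw [hv, ← norm_mul, mul_assoc (Complex.I * (ν : ℂ))]
  have hsm := hφ.contDiff_space t
  have hper := hφ.periodic t
  have hc1 : Continuous fun x => deriv (fun τ => φ τ x) t :=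
    hφ.continuous_deriv_time.comp (continuous_const.prodMk continuous_id)
  have hc2 : Continuous (iteratedDeriv 4 (φ t)) :=
    (contDiff_infty.1 hsm 4).continuous_iteratedDeriv 4 le_rfl
  have hc3 : Continuous (iteratedDeriv 2 (φ t)) :=
    (contDiff_infty.1 hsm 2).continuous_iteratedDeriv 2 le_rfl
  obtain ⟨M1, hM1⟩ := isCompact_Icc.exists_bound_of_continuousOn (s := Icc 0 L) hc1.continuousOn
  obtain ⟨M2, hM2⟩ := isCompact_Icc.exists_bound_of_continuousOn (s := Icc 0 L) hc2.continuousOn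
  obtain ⟨M3, hM3⟩ := isCompact_Icc.exists_bound_of_continuousOn (s := Icc 0 L) hc3.continuousOn
  set q : ℤ → ℂ := fun k =>
    -(ν : ℂ) ^ 2 * derivConv (fun j => a j t) (fun j => a j t) k with hq
  have hqB : ∀ k, ‖q k‖ ≤ ν ^ 2 * B k := by
    intro k
    rw [hq, norm_mul, norm_neg, norm_pow, Complex.norm_real, Real.norm_eq_abs, abs_of_pos hν]
    exact mul_le_mul_of_nonneg_left (hle' k).2 (by positivity)
  have h1 := hasSum_integral_fourier (L := L)
    (f := fun x => u (x : AddCircle L) * deriv (fun τ => φ τ x) t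
      - u (x : AddCircle L) * iteratedDeriv 4 (φ t) x
      - v (x : AddCircle L) ^ 2 * iteratedDeriv 2 (φ t) x)
    (d := fun k x => a k t * (deriv (fun τ => φ τ x) t : ℝ) -
      a k t * (iteratedDeriv 4 (φ t) x : ℝ) - q k * (iteratedDeriv 2 (φ t) x : ℝ))
    (B := fun k => B k * M1 + B k * M2 + ν ^ 2 * B k * M3) (fun k => by fun_prop)
    (fun k x hx => by
      refine (norm_sub_le _ _).trans (add_le_add ((norm_sub_le _ _).trans (add_le_add ?_ ?_)) ?_)
      · rw [norm_mul, Complex.norm_real]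
        exact mul_le_mul (hle' k).1 (hM1 x hx) (norm_nonneg _) (hB0 k)
      · rw [norm_mul, Complex.norm_real]
        exact mul_le_mul (hle' k).1 (hM2 x hx) (norm_nonneg _) (hB0 k)
      · rw [norm_mul, Complex.norm_real]
        have := hB0 k
        exact mul_le_mul (hqB k) (hM3 x hx) (norm_nonneg _) (by positivity))
    (((hBs.mul_right M1).add (hBs.mul_right M2)).add ((hBs.mul_left (ν ^ 2)).mul_right M3)) (by
      filter_upwards [ae_restrict_of_ae_haarAddCircle (ae_hasSum_of_summable_coeff hus),
        ae_restrict_of_ae_haarAddCircle (ae_hasSum_of_summable_coeff hvs)] with x hx1 hx2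
      simp only [hu] at hx1
      simp only [hv] at hx2
      have hx3 := hasSum_sq_of_hasSum hka hx2
      have := ((hx1.mul_right ((deriv (fun τ => φ τ x) t : ℝ) : ℂ)).sub
        (hx1.mul_right ((iteratedDeriv 4 (φ t) x : ℝ) : ℂ))).sub
        (hx3.mul_right ((iteratedDeriv 2 (φ t) x : ℝ) : ℂ))
      push_cast
      refine this.congr_fun fun k => ?_
      rw [hq]
      ring)
  refine h1.congr_fun fun k => ?_
  have hm4 := mode_iteratedDeriv hsm hper 4 k
  have hm2 := mode_iteratedDeriv hsm hper 2 k
  rw [← hνdef] at hm4 hm2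
  have hi : ∀ ψ : ℝ → ℝ, Continuous ψ → ∀ z : ℂ, IntervalIntegrable
      (fun x : ℝ => z * (fourier k (x : AddCircle L) * (ψ x : ℂ))) volume 0 L := fun ψ hψ z =>
    (continuous_const.mul ((continuous_fourier_coe k).mul
      (Complex.continuous_ofReal.comp hψ))).intervalIntegrable _ _
  have h2 : ∫ x in (0 : ℝ)..L, fourier k (x : AddCircle L) *
      (a k t * (deriv (fun τ => φ τ x) t : ℝ) - a k t * (iteratedDeriv 4 (φ t) x : ℝ) -
        q k * (iteratedDeriv 2 (φ t) x : ℝ)) =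
      a k t * mode L (fun x => deriv (fun τ => φ τ x) t) k -
        a k t * mode L (iteratedDeriv 4 (φ t)) k - q k * mode L (iteratedDeriv 2 (φ t)) k := by
    unfold mode
    rw [← intervalIntegral.integral_const_mul, ← intervalIntegral.integral_const_mul,
      ← intervalIntegral.integral_const_mul,
      ← intervalIntegral.integral_sub (hi _ hc1 _) (hi _ hc2 _),
      ← intervalIntegral.integral_sub ((hi _ hc1 _).sub (hi _ hc2 _)) (hi _ hc3 _)]
    refine intervalIntegral.integral_congr fun x _ => ?_
    ring
  rw [h2, hm4, hm2, modeTerm, quadratic]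
  simp only [hq, Complex.real_smul]
  push_cast
  have hI4 : Complex.I ^ 4 = 1 := Complex.I_pow_four
  have hI2 : Complex.I ^ 2 = -1 := Complex.I_sq
  have e4 : (-(Complex.I * (ν : ℂ) * k)) ^ 4 = ((ν : ℂ) * k) ^ 4 := by
    calc (-(Complex.I * (ν : ℂ) * k)) ^ 4 = Complex.I ^ 4 * ((ν : ℂ) * k) ^ 4 := by ring
      _ = _ := by rw [hI4, one_mul]
  have e2 : (-(Complex.I * (ν : ℂ) * k)) ^ 2 = -((ν : ℂ) * k) ^ 2 := by
    calc (-(Complex.I * (ν : ℂ) * k)) ^ 2 = Complex.I ^ 2 * ((ν : ℂ) * k) ^ 2 := by ring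
      _ = _ := by rw [hI2, neg_one_mul]
  rw [e4, e2]
  ring

theorem isSolution [Fact (0 < L)] (ha : IsCoeffSolution (2 * Real.pi / L) p c T a) (hT : 0 < T)
    (hc0 : c 0 = 0)
    (hc : Summable fun k : ℤ => |(k : ℝ)| ^ (2 * (p + 1)) * ‖c k‖ ^ 2)
    {h hx : ℝ → L2 L} (hh : ∀ t ∈ Ioo 0 T, ∀ k, coeff (h t) k = a k t)
    (hhx : ∀ t ∈ Ioo 0 T, ∀ k,
      coeff (hx t) k = Complex.I * ((2 * Real.pi / L : ℝ) : ℂ) * k * a k t) :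
    IsSolution T h := by
  have hL : 0 < L := Fact.out
  have hν : 0 < 2 * Real.pi / L := by positivity
  refine ⟨hx, fun t ht => ?_, fun φ hφ => ?_⟩
  · have hs := ha.summable_pow_mul_norm hν hc0 hc (Ioo_subset_Ioc_self ht)
    refine isWeakDeriv_of_coeff ?_ ?_ fun k => by rw [hh t ht, hhx t ht]
    · refine (hs 0).congr fun k => ?_
      rw [hh t ht, pow_zero, one_mul]
    · refine ((hs 1).mul_left ‖Complex.I * ((2 * Real.pi / L : ℝ) : ℂ)‖).congr fun k => ?_
      rw [hhx t ht, pow_one, mul_assoc _ (k : ℂ), norm_mul _ ((k : ℂ) * _), norm_mul (k : ℂ),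
        Complex.norm_intCast]
  · obtain ⟨D, hD, hbound⟩ := ha.exists_norm_modeTerm_le hν hc0 hc hL.le hφ
    have hsum : ∀ t ∈ Ioo 0 T, HasSum (fun k => modeTerm (2 * Real.pi / L) L a φ k t)
        ((testedEquation φ t (h t) (hx t) : ℝ) : ℂ) := fun t ht =>
      ha.hasSum_modeTerm hc0 hc hφ ht (hh t ht) (hhx t ht)
    have hne : ∀ᵐ t ∂(volume : Measure ℝ), t ≠ T :=
      (countable_singleton T).ae_notMem _
    constructor
    · have hcont : ContinuousOn (fun t => (∑' k, modeTerm (2 * Real.pi / L) L a φ k t).re)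
          (Icc 0 T) :=
        Complex.continuous_re.comp_continuousOn (continuousOn_tsum
          (fun k => (ha.continuous_modeTerm hφ k).continuousOn) hD hbound)
      have hcont' : IntervalIntegrable
          (fun t => (∑' k, modeTerm (2 * Real.pi / L) L a φ k t).re) volume 0 T := by
        refine ContinuousOn.intervalIntegrable ?_
        rwa [uIcc_of_le hT.le]
      refine hcont'.congr_ae ?_
      rw [uIoc_of_le hT.le, Filter.EventuallyEq, ae_restrict_iff' measurableSet_Ioc]
      filter_upwards [hne] with t htT ht
      rw [(hsum t ⟨ht.1, lt_of_le_of_ne ht.2 htT⟩).tsum_eq, Complex.ofReal_re]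
    · have h1 := intervalIntegral.hasSum_integral_of_dominated_convergence (a := 0) (b := T)
        (μ := volume) (F := modeTerm (2 * Real.pi / L) L a φ)
        (f := fun t => ((testedEquation φ t (h t) (hx t) : ℝ) : ℂ)) (fun k _ => D k)
        (fun k => (ha.continuous_modeTerm hφ k).aestronglyMeasurable)
        (fun k => Filter.Eventually.of_forall fun t ht => by
          rw [uIoc_of_le hT.le] at ht
          exact hbound k t (Ioc_subset_Icc_self ht))
        (Filter.Eventually.of_forall fun t _ => hD) intervalIntegrable_const (by
          filter_upwards [hne] with t htT ht
          rw [uIoc_of_le hT.le] at ht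
          exact hsum t ⟨ht.1, lt_of_le_of_ne ht.2 htT⟩)
      simp only [ha.integral_modeTerm hL.le hT.le hφ] at h1
      have h2 := h1.unique hasSum_zero
      rw [intervalIntegral.integral_ofReal] at h2
      exact_mod_cast h2

end IsCoeffSolution

/-! ### The solution -/

namespace IsCoeffSolution

variable {ν : ℝ} {p : ℕ} {c : ℤ → ℂ} {T : ℝ} {a : ℤ → ℝ → ℂ} {L : ℝ} [Fact (0 < L)]

/-- At positive times the coefficients belong to functions in every `Ḣ^s`. -/
theorem exists_hdot (ha : IsCoeffSolution ν p c T a) (hν : 0 < ν) (hc0 : c 0 = 0)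
    (hc : Summable fun k : ℤ => |(k : ℝ)| ^ (2 * (p + 1)) * ‖c k‖ ^ 2) {s : ℝ} {m : ℕ}
    (hs : s = m) {t : ℝ} (ht : t ∈ Ioo 0 T) :
    ∃ u : HDot L s, ∀ k, coeff (HDot.toL2 u) k = a k t := by
  refine HDot.exists_coeff_eq hs ?_ (fun k => ha.symm k t)
    (ha.apply_zero hc0 (Ioo_subset_Icc_self ht)) ?_
  · simpa using ha.summable_pow_mul_norm hν hc0 hc (Ioo_subset_Ioc_self ht) 0
  · obtain ⟨D, hD, hbound⟩ := ha.exists_summable_bound hν hc0 hc ht.1 (2 * m)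
    exact Summable.of_nonneg_of_le (fun k => by positivity) (hbound t ⟨le_rfl, ht.2.le⟩) hD

theorem exists_derivative (ha : IsCoeffSolution ν p c T a) (hν : 0 < ν) (hc0 : c 0 = 0)
    (hc : Summable fun k : ℤ => |(k : ℝ)| ^ (2 * (p + 1)) * ‖c k‖ ^ 2) {t : ℝ}
    (ht : t ∈ Ioo 0 T) :
    ∃ v : L2 L, ∀ k, coeff v k = Complex.I * (ν : ℂ) * k * a k t := by
  have hs := ha.summable_pow_mul_norm hν hc0 hc (Ioo_subset_Ioc_self ht) 1
  obtain ⟨v, hv, -⟩ := exists_coeff_eq (L := L) (c := fun k => Complex.I * (ν : ℂ) * k * a k t)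
    ((hs.mul_left ‖Complex.I * (ν : ℂ)‖).congr fun k => by
      rw [pow_one, mul_assoc _ (k : ℂ), norm_mul _ ((k : ℂ) * _), norm_mul (k : ℂ),
        Complex.norm_intCast])
    (fun k => by
      rw [ha.symm]
      simp only [map_mul, Complex.conj_I, Complex.conj_ofReal, map_intCast]
      push_cast
      ring)
  exact ⟨v, hv⟩

end IsCoeffSolution

end SurfaceGrowth

end

theorem proposition2p8 (L : ℝ) [Fact (0 < L)] (n : ℕ) (hn : 1 ≤ n)
    (h₀ : SurfaceGrowth.HDot L (n : ℝ)) :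
    ∃ T : ℝ, 0 < T ∧ ∃ h : ℝ → SurfaceGrowth.HDot L (n : ℝ),
      ContinuousOn h (Set.Ico 0 T) ∧
      SurfaceGrowth.MemL2Loc T ((n : ℝ) + 2) (fun t => (h t).toL2) ∧
      SurfaceGrowth.IsSolution T (fun t => (h t).toL2) ∧
      h 0 = h₀ := by
  open SurfaceGrowth in
  obtain ⟨p, rfl⟩ := Nat.exists_eq_add_of_le' hn
  have hL : 0 < L := Fact.out
  have hν : 0 < 2 * Real.pi / L := by positivity
  have hc0 : coeff h₀.toL2 0 = 0 := h₀.2.1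
  have hc : Summable fun k : ℤ => |(k : ℝ)| ^ (2 * (p + 1)) * ‖coeff h₀.toL2 k‖ ^ 2 := by
    refine Summable.congr (f := fun k : ℤ => |(k : ℝ)| ^ (2 * ((p + 1 : ℕ) : ℝ)) *
      ‖coeff h₀.toL2 k‖ ^ 2) h₀.2.2 fun k => ?_
    rw [abs_rpow_two_mul rfl]
  obtain ⟨T, hT, a, ha⟩ := exists_isCoeffSolution hν hc (coeff_neg h₀.toL2)
  have hex : ∀ t, ∃ u : HDot L ((p + 1 : ℕ) : ℝ), t ∈ Set.Ico 0 T →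
      ∀ k, coeff u.toL2 k = a k t := by
    intro t
    by_cases ht : t ∈ Set.Ioo 0 T
    · obtain ⟨u, hu⟩ := ha.exists_hdot (L := L) hν hc0 hc (s := ((p + 1 : ℕ) : ℝ)) rfl ht
      exact ⟨u, fun _ => hu⟩
    · refine ⟨h₀, fun ht' k => ?_⟩
      have : t = 0 := by
        by_contra h
        exact ht ⟨lt_of_le_of_ne ht'.1 (Ne.symm h), ht'.2⟩
      rw [this, ha.initial]
  have hs2 : ((p + 1 : ℕ) : ℝ) + 2 = ((p + 3 : ℕ) : ℝ) := by push_cast; ring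
  have hex2 : ∀ t, ∃ u : HDot L (((p + 1 : ℕ) : ℝ) + 2), t ∈ Set.Ioo 0 T →
      ∀ k, coeff u.toL2 k = a k t := by
    intro t
    by_cases ht : t ∈ Set.Ioo 0 T
    · obtain ⟨u, hu⟩ := ha.exists_hdot (L := L) hν hc0 hc hs2 ht
      exact ⟨u, fun _ => hu⟩
    · exact ⟨0, fun h => absurd h ht⟩
  have hexd : ∀ t, ∃ v : L2 L, t ∈ Set.Ioo 0 T →
      ∀ k, coeff v k = Complex.I * ((2 * Real.pi / L : ℝ) : ℂ) * k * a k t := by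
    intro t
    by_cases ht : t ∈ Set.Ioo 0 T
    · obtain ⟨v, hv⟩ := ha.exists_derivative (L := L) hν hc0 hc ht
      exact ⟨v, fun _ => hv⟩
    · exact ⟨0, fun h => absurd h ht⟩
  choose h hh using hex
  choose g hg using hex2
  choose hx hhx using hexd
  have hh' : ∀ t ∈ Set.Ioo 0 T, ∀ k, coeff (h t).toL2 k = a k t := fun t ht =>
    hh t (Set.Ioo_subset_Ico_self ht)
  refine ⟨T, hT, h, ha.continuousOn_hdot hc rfl hh, ⟨g, ?_, fun T' hT' => ?_⟩,
    ha.isSolution hT hc0 hc hh' hhx, ?_⟩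
  · filter_upwards [MeasureTheory.ae_restrict_mem measurableSet_Ioo] with t ht
    exact eq_of_coeff fun k => by rw [hg t ht, hh' t ht]
  · exact (ha.memLp_hdot hν hc0 hc hs2 hg).mono_measure
      (MeasureTheory.Measure.restrict_mono_set _ (Set.Ioo_subset_Ioo_right hT'.le))
  · refine HDot.eq_of_coeff fun k => ?_
    rw [hh 0 ⟨le_rfl, hT⟩, ha.initial]
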